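/- Let $H$ be a real Hilbert space with complexification $H_{\mathbb C}$, let $-1<q<1$, let $\mathcal F(H)=\bigoplus_{n\ge 0}H_{\mathbb C}^{\otimes n}$ be the algebraic Fock space with vacuum $\Omega$, and let $\mathcal F_q(H)$ be its completion for the $q$-inner product $$\langle h_1\otimes\cdots\otimes h_n,\,k_1\otimes\cdots\otimes k_m\rangle_q=\delta_{m,n}\sum_{\sigma\in S_n}q^{\iota(\sigma)}\prod_j\langle h_j,k_{\sigma(j)}\rangle ,$$ where $\iota(\sigma)$ is the number of inversions of $\sigma$. For $h\in H$ let $l_q(h)$ be the bounded operator on $\mathcal F_q(H)$ with $l_q(h)\xi=h\otimes\xi$ for $\xi\in\mathcal F(H)$, let $s_q(h)=l_q(h)+l_q(h)^*$, and let $\Gamma_q(H)=\{s_q(h): h\in H\}''$. For $\xi\in\mathcal F(H)$ let $W(\xi)$ be the element of $\Gamma_q(H)$ with $W(\xi)\Omega=\xi$; it exists, is unique, and depends linearly on $\xi$. For $0\le k\le n$ let $\beta_{n,k}$ be the linear map on $H_{\mathbb C}^{\otimes (n-k)}\otimes H_{\mathbb C}^{\otimes k}$ with $$\beta_{n,k}\big((h_1\otimes\cdots\otimes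 h_{n-k})\otimes(h_{n-k+1}\otimes\cdots\otimes h_n)\big)=W(h_1\otimes\cdots\otimes h_n).$$ For $n=a+b$ let $R^*_{n,b}:H_{\mathbb C}^{\otimes n}\to H_{\mathbb C}^{\otimes a}\otimes H_{\mathbb C}^{\otimes b}$ be the map $$R^*_{n,b}(\xi)=\sum_{A\subset\{1,\dots,n\},\,|A|=b}q^{\iota(A)}\,\xi_{A^c}\otimes\xi_A ,$$ where, for $\xi=h_1\otimes\cdots\otimes h_n$, $\xi_A$ is the tensor of the $h_i$ with $i\in A$ in increasing order of $i$, and $\iota(A)=|\{(a,c)\in A\times A^c: a<c\}|$. Let $v_{a+b,b}(\xi\otimes\eta)=W(\xi)W(\eta)$ for $\xi\in H_{\mathbb C}^{\otimes a}$, $\eta\in H_{\mathbb C}^{\otimes b}$, and let $m_j:H_{\mathbb C}^{\otimes j}\otimes H_{\mathbb C}^{\otimes j}\to\mathbb C$ be the $q$-duality pairing $$m_j\big((h_1\otimes\cdots\otimes h_j)\otimes(k_1\otimes\cdots\otimes k_j)\big)=\sum_{\sigma\in S_j}q^{\iota(\sigma)}\prod_s\langle h_s,k_{\sigma(s)}\rangle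 ,$$ with $\langle\cdot,\cdot\rangle$ here the complex bilinear extension of the inner product of $H$. For $0\le j\le\min(k,n-k)$ put $$w^j_{n,k}=v_{n-2j,k-j}\circ(\mathrm{Id}_{n-k-j}\otimes m_j\otimes \mathrm{Id}_{k-j})\circ(R^*_{n-k,j}\otimes R^*_{k,k-j}),$$ and put $w^j_{n,k}=0$ for larger $j$. Then, for all $0\le k\le n$, $$\beta_{n,k}=\sum_{j=0}^{\max(k,\,n-k)}(-1)^j q^{\binom j2}\,w^j_{n,k}.$$ -/

import Mathlib

open scoped TensorProduct DirectSum

noncomputable section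

namespace QGaussian

/-! ### The complexification of a real Hilbert space -/

section Complexification

variable (H : Type*) [NormedAddCommGroup H] [InnerProductSpace ℝ H]

/-- The complexification `H_ℂ = ℂ ⊗_ℝ H`. -/
abbrev Cplx : Type _ := ℂ ⊗[ℝ] H

/-- The complex bilinear extension of the real inner product,
`(z ⊗ h, w ⊗ k) ↦ z w ⟨h, k⟩`. -/
def bil : Cplx H →ₗ[ℂ] Cplx H →ₗ[ℂ] ℂ :=
  LinearMap.BilinForm.baseChange ℂ (innerₗ H : LinearMap.BilinForm ℝ H)

/-- The canonical conjugation `z ⊗ h ↦ conj z ⊗ h` of `H_ℂ`. -/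
def conjC : Cplx H →ₗ[ℝ] Cplx H :=
  TensorProduct.map Complex.conjAe.toLinearMap LinearMap.id

variable {H}

@[simp] lemma bil_tmul (z w : ℂ) (h k : H) :
    bil H (z ⊗ₜ h) (w ⊗ₜ k) = (inner ℝ h k : ℝ) • (z * w) := rfl

@[simp] lemma conjC_tmul (z : ℂ) (h : H) :
    conjC H (z ⊗ₜ h) = (starRingEnd ℂ z) ⊗ₜ h := rfl

lemma conjC_smul (c : ℂ) (x : Cplx H) :
    conjC H (c • x) = (starRingEnd ℂ c) • conjC H x := by
  induction x using TensorProduct.induction_on with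
  | zero => simp
  | tmul z h => simp [TensorProduct.smul_tmul']
  | add x y hx hy => simp [smul_add, hx, hy]

lemma conjC_conjC (x : Cplx H) : conjC H (conjC H x) = x := by
  induction x using TensorProduct.induction_on with
  | zero => simp
  | tmul z h => simp
  | add x y hx hy => simp [hx, hy]

lemma bil_conjC (x y : Cplx H) :
    bil H (conjC H x) (conjC H y) = starRingEnd ℂ (bil H x y) := by
  induction x using TensorProduct.induction_on with
  | zero => simp
  | add x x' hx hx' => simp [hx, hx']
  | tmul z h =>
    induction y using TensorProduct.induction_on with
    | zero => simp
    | add y y' hy hy' => simp only [map_add, hy, hy']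
    | tmul w k => simp

lemma bil_symm (x y : Cplx H) : bil H x y = bil H y x := by
  induction x using TensorProduct.induction_on with
  | zero => simp
  | add x x' hx hx' => simp [hx, hx']
  | tmul z h =>
    induction y using TensorProduct.induction_on with
    | zero => simp
    | add y y' hy hy' => simp only [map_add, LinearMap.add_apply, hy, hy']
    | tmul w k => simp [real_inner_comm, mul_comm z w]

lemma exists_re_im (x : Cplx H) :
    ∃ a b : H, x = (1 : ℂ) ⊗ₜ[ℝ] a + Complex.I ⊗ₜ[ℝ] b := by
  induction x using TensorProduct.induction_on with
  | zero => exact ⟨0, 0, by simp⟩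
  | add x y hx hy =>
    obtain ⟨a, b, rfl⟩ := hx
    obtain ⟨c, d, rfl⟩ := hy
    exact ⟨a + c, b + d, by simp only [TensorProduct.tmul_add]; abel⟩
  | tmul z h =>
    refine ⟨z.re • h, z.im • h, ?_⟩
    rw [← TensorProduct.smul_tmul, ← TensorProduct.smul_tmul, ← TensorProduct.add_tmul]
    congr 1
    apply Complex.ext <;> simp

open scoped ComplexOrder in
lemma bil_conjC_self_nonneg (x : Cplx H) : 0 ≤ bil H (conjC H x) x := by
  obtain ⟨a, b, rfl⟩ := exists_re_im x
  have : bil H (conjC H ((1 : ℂ) ⊗ₜ[ℝ] a + Complex.I ⊗ₜ[ℝ] b))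
      ((1 : ℂ) ⊗ₜ[ℝ] a + Complex.I ⊗ₜ[ℝ] b) =
      ((inner ℝ a a + inner ℝ b b : ℝ) : ℂ) := by
    simp only [map_add, conjC_tmul, LinearMap.add_apply, bil_tmul, map_one, Complex.conj_I]
    apply Complex.ext <;> simp [real_inner_comm]
  rw [this]
  exact_mod_cast add_nonneg real_inner_self_nonneg real_inner_self_nonneg

end Complexification

/-! ### Tensor powers of `H_ℂ` and the `q`-deformed form -/

/-- A complex vector space with the conjugate scalar multiplication; only used to lift
conjugation to tensor powers. -/
def ConjSpace (M : Type*) : Type _ := M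

instance (M : Type*) [AddCommGroup M] : AddCommGroup (ConjSpace M) :=
  inferInstanceAs (AddCommGroup M)

instance (M : Type*) [AddCommGroup M] [Module ℂ M] : Module ℂ (ConjSpace M) :=
  Module.compHom M (starRingEnd ℂ)

section Tensors

variable (H : Type*) [NormedAddCommGroup H] [InnerProductSpace ℝ H]

/-- The `n`-th (algebraic) tensor power `H_ℂ^{⊗ n}`. -/
abbrev Tens (n : ℕ) : Type _ := ⨂[ℂ]^n (Cplx H)

/-- The conjugation of `H_ℂ^{⊗ n}` as a linear map into the conjugate space. -/
def conjTensAux (n : ℕ) : Tens H n →ₗ[ℂ] ConjSpace (Tens H n) :=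
  PiTensorProduct.lift
    { toFun := fun v => (PiTensorProduct.tprod ℂ (fun i => conjC H (v i)) : Tens H n)
      map_update_add' := by
        intro _ v i x y
        have key : ∀ z : Cplx H, (fun j => conjC H (Function.update v i z j)) =
            Function.update (fun j => conjC H (v j)) i (conjC H z) := fun z =>
          Function.comp_update (conjC H) v i z
        rw [key, key, key, map_add]
        exact (PiTensorProduct.tprod ℂ).map_update_add _ _ _ _
      map_update_smul' := by
        intro _ v i c x
        have key : ∀ z : Cplx H, (fun j => conjC H (Function.update v i z j)) =
            Function.update (fun j => conjC H (v j)) i (conjC H z) := fun z =>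
          Function.comp_update (conjC H) v i z
        rw [key, key, conjC_smul]
        exact (PiTensorProduct.tprod ℂ).map_update_smul _ _ _ _ }

/-- The antilinear conjugation `h₁ ⊗ ⋯ ⊗ hₙ ↦ conj h₁ ⊗ ⋯ ⊗ conj hₙ` of `H_ℂ^{⊗ n}`. -/
def conjTens (n : ℕ) : Tens H n →ₗ⋆[ℂ] Tens H n where
  toFun := fun x => conjTensAux H n x
  map_add' := fun x y => (conjTensAux H n).map_add x y
  map_smul' := fun c x => (conjTensAux H n).map_smul c x

/-- The number of inversions of a permutation. -/
def inversions {n : ℕ} (σ : Equiv.Perm (Fin n)) : ℕ :=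
  (Finset.univ.filter fun p : Fin n × Fin n => p.1 < p.2 ∧ σ p.2 < σ p.1).card

/-- The undeformed bilinear pairing `(h₁ ⊗ ⋯ ⊗ hₙ, k₁ ⊗ ⋯ ⊗ kₙ) ↦ ∏ⱼ ⟨hⱼ, kⱼ⟩`. -/
def pairing (n : ℕ) : Tens H n →ₗ[ℂ] Tens H n →ₗ[ℂ] ℂ :=
  PiTensorProduct.dualDistrib ∘ₗ PiTensorProduct.map (fun _ => bil H)

/-- The `q`-deformed bilinear duality pairing
`(h₁ ⊗ ⋯ ⊗ hₙ, k₁ ⊗ ⋯ ⊗ kₙ) ↦ ∑_{σ ∈ Sₙ} q^{ι(σ)} ∏ⱼ ⟨hⱼ, k_{σ(j)}⟩`. -/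
def qPairing (q : ℝ) (n : ℕ) : Tens H n →ₗ[ℂ] Tens H n →ₗ[ℂ] ℂ :=
  ∑ σ : Equiv.Perm (Fin n), ((q : ℂ) ^ inversions σ) •
    (pairing H n).compl₂ (PiTensorProduct.reindex ℂ (fun _ => Cplx H) σ.symm).toLinearMap

/-- The `q`-deformed sesquilinear form on `H_ℂ^{⊗ n}`, antilinear in the first variable. -/
def qForm (q : ℝ) (n : ℕ) : Tens H n →ₗ⋆[ℂ] Tens H n →ₗ[ℂ] ℂ :=
  (qPairing H q n).comp (conjTens H n)

variable {H}

@[simp] lemma conjTens_tprod {n : ℕ} (v : Fin n → Cplx H) :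
    conjTens H n (PiTensorProduct.tprod ℂ v) =
      PiTensorProduct.tprod ℂ (fun i => conjC H (v i)) := by
  change conjTensAux H n (PiTensorProduct.tprod ℂ v) = _
  rw [conjTensAux, PiTensorProduct.lift.tprod]
  rfl

lemma pairing_tprod {n : ℕ} (v w : Fin n → Cplx H) :
    pairing H n (PiTensorProduct.tprod ℂ v) (PiTensorProduct.tprod ℂ w) =
      ∏ j, bil H (v j) (w j) := by
  simp [pairing, PiTensorProduct.map_tprod, PiTensorProduct.dualDistrib_apply]

lemma qPairing_tprod (q : ℝ) {n : ℕ} (v w : Fin n → Cplx H) :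
    qPairing H q n (PiTensorProduct.tprod ℂ v) (PiTensorProduct.tprod ℂ w) =
      ∑ σ : Equiv.Perm (Fin n), (q : ℂ) ^ inversions σ * ∏ j, bil H (v j) (w (σ j)) := by
  simp [qPairing, LinearMap.sum_apply, pairing_tprod]

lemma qForm_tprod (q : ℝ) {n : ℕ} (v w : Fin n → Cplx H) :
    qForm H q n (PiTensorProduct.tprod ℂ v) (PiTensorProduct.tprod ℂ w) =
      ∑ σ : Equiv.Perm (Fin n),
        (q : ℂ) ^ inversions σ * ∏ j, bil H (conjC H (v j)) (w (σ j)) := by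
  simp [qForm, qPairing_tprod]

lemma inversions_inv {n : ℕ} (σ : Equiv.Perm (Fin n)) : inversions σ⁻¹ = inversions σ := by
  unfold inversions
  refine Finset.card_bij' (fun p _ => (σ⁻¹ p.2, σ⁻¹ p.1)) (fun p _ => (σ p.2, σ p.1)) ?_ ?_ ?_ ?_
  all_goals simp +contextual

lemma qForm_conj_symm (q : ℝ) (n : ℕ) (x y : Tens H n) :
    starRingEnd ℂ (qForm H q n y x) = qForm H q n x y := by
  induction x using PiTensorProduct.induction_on with
  | add x x' hx hx' => simp only [map_add, LinearMap.add_apply, hx, hx']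
  | smul_tprod r v =>
    induction y using PiTensorProduct.induction_on with
    | add y y' hy hy' => simp only [map_add, LinearMap.add_apply, hy, hy']
    | smul_tprod s w =>
      simp only [map_smulₛₗ, LinearMap.smul_apply, smul_eq_mul, map_mul, qForm_tprod, map_sum,
        map_prod, map_pow, Complex.conj_ofReal, RingHom.id_apply, Complex.conj_conj]
      have : ∑ σ : Equiv.Perm (Fin n), (q : ℂ) ^ inversions σ *
            ∏ j, starRingEnd ℂ (bil H (conjC H (w j)) (v (σ j))) =
          ∑ σ : Equiv.Perm (Fin n), (q : ℂ) ^ inversions σ *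
            ∏ j, bil H (conjC H (v j)) (w (σ j)) := by
        refine Fintype.sum_equiv (Equiv.inv _) _ _ fun σ => ?_
        rw [Equiv.inv_apply, inversions_inv]
        congr 1
        refine Fintype.prod_equiv σ _ _ fun j => ?_
        rw [← bil_conjC, conjC_conjC, bil_symm]
        exact congrArg (fun i => bil H (conjC H (v (σ j))) (w i)) (σ.symm_apply_apply j).symm
      rw [this]
      ring

/-! #### Positivity -/

section Positivity

open scoped ComplexOrder

lemma posSemidef_gram {ι : Type*} [Fintype ι] (v : ι → Cplx H) :
    (Matrix.of fun a b => bil H (conjC H (v a)) (v b)).PosSemidef := by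
  rw [Matrix.posSemidef_iff_dotProduct_mulVec]
  refine ⟨?_, fun c => ?_⟩
  · ext a b
    simp only [Matrix.conjTranspose_apply, Matrix.of_apply]
    change starRingEnd ℂ _ = _
    rw [← bil_conjC, conjC_conjC, bil_symm]
  · have h := bil_conjC_self_nonneg (∑ a, c a • v a)
    convert h using 1
    simp only [map_sum, conjC_smul, map_smul, LinearMap.sum_apply, LinearMap.smul_apply,
      dotProduct, Matrix.mulVec, Matrix.of_apply, smul_eq_mul, Finset.mul_sum, Pi.star_apply]
    rw [Finset.sum_comm]
    refine Finset.sum_congr rfl fun a _ => Finset.sum_congr rfl fun b _ => ?_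
    change starRingEnd ℂ _ * _ = _
    ring

lemma posSemidef_ones {ι : Type*} [Fintype ι] :
    (Matrix.of fun _ _ : ι => (1 : ℂ)).PosSemidef := by
  have := Matrix.posSemidef_vecMulVec_self_star (fun _ : ι => (1 : ℂ))
  convert this using 1
  ext a b
  simp [Matrix.vecMulVec_apply]

lemma posSemidef_prod {ι κ : Type*} [Fintype ι] (s : Finset κ) (K : κ → ι → ι → ℂ)
    (hK : ∀ k ∈ s, (Matrix.of (K k)).PosSemidef) :
    (Matrix.of fun a b => ∏ k ∈ s, K k a b).PosSemidef := by
  classical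
  induction s using Finset.induction_on with
  | empty => simpa using posSemidef_ones
  | insert k s hk ih =>
    have h1 := hK k (Finset.mem_insert_self _ _)
    have h2 := ih fun j hj => hK j (Finset.mem_insert_of_mem hj)
    have heq : (Matrix.of fun a b => ∏ j ∈ insert k s, K j a b) =
        Matrix.hadamard (Matrix.of (K k)) (Matrix.of fun a b => ∏ j ∈ s, K j a b) := by
      ext a b
      simp [Finset.prod_insert hk]
    rw [heq]
    exact h1.hadamard h2

lemma posSemidef_sign {ι : Type*} [Fintype ι] (q : ℝ) (h1 : -1 ≤ q) (h2 : q ≤ 1)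
    (P : ι → Prop) [DecidablePred P] :
    (Matrix.of fun a b => if (P a ↔ P b) then (1 : ℂ) else (q : ℂ)).PosSemidef := by
  have hA := (posSemidef_ones (ι := ι)).smul (a := (((1 + q) / 2 : ℝ) : ℂ))
    (by exact_mod_cast (by linarith : (0 : ℝ) ≤ (1 + q) / 2))
  have hB := (Matrix.posSemidef_vecMulVec_self_star
    (fun a : ι => if P a then (1 : ℂ) else -1)).smul (a := (((1 - q) / 2 : ℝ) : ℂ))
    (by exact_mod_cast (by linarith : (0 : ℝ) ≤ (1 - q) / 2))
  convert hA.add hB using 1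
  ext a b
  by_cases ha : P a <;> by_cases hb : P b <;> simp [ha, hb, Matrix.vecMulVec_apply] <;> ring

lemma pow_inversions (q : ℂ) {n : ℕ} (ρ τ : Equiv.Perm (Fin n)) :
    q ^ inversions (τ * ρ⁻¹) =
      ∏ p ∈ Finset.univ.filter (fun p : Fin n × Fin n => p.1 < p.2),
        if (ρ p.1 < ρ p.2 ↔ τ p.1 < τ p.2) then (1 : ℂ) else q := by
  rw [Finset.prod_ite]
  simp only [Finset.prod_const_one, one_mul, Finset.prod_const]
  congr 1
  unfold inversions
  rw [Finset.filter_filter]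
  refine Finset.card_bij'
    (fun p _ => if ρ⁻¹ p.1 < ρ⁻¹ p.2 then (ρ⁻¹ p.1, ρ⁻¹ p.2) else (ρ⁻¹ p.2, ρ⁻¹ p.1))
    (fun p _ => if ρ p.1 < ρ p.2 then (ρ p.1, ρ p.2) else (ρ p.2, ρ p.1)) ?_ ?_ ?_ ?_
  · rintro ⟨a, b⟩ h
    obtain ⟨a, rfl⟩ := ρ.surjective a
    obtain ⟨b, rfl⟩ := ρ.surjective b
    replace h : ρ a < ρ b ∧ τ b < τ a := by simpa using (Finset.mem_filter.1 h).2
    have hne : a ≠ b := fun e => by subst e; exact absurd h.1 (lt_irrefl _)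
    rcases lt_or_gt_of_ne hne with hab | hab
    · simp [hab, h.1, h.2.le]
    · simp [hab, hab.not_gt, h.1.le, h.2]
  · rintro ⟨a, b⟩ h
    simp only [Finset.mem_filter, Finset.mem_univ, true_and] at h ⊢
    have hne : τ a ≠ τ b := fun e => h.1.ne (τ.injective e)
    have hne' : ρ a ≠ ρ b := fun e => h.1.ne (ρ.injective e)
    rcases lt_or_gt_of_ne hne' with hab | hab <;> rcases lt_or_gt_of_ne hne with hab' | hab' <;>
      simp_all [hab.not_gt, hab'.not_gt]
  · rintro ⟨a, b⟩ h
    obtain ⟨a, rfl⟩ := ρ.surjective a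
    obtain ⟨b, rfl⟩ := ρ.surjective b
    replace h : ρ a < ρ b ∧ τ b < τ a := by simpa using (Finset.mem_filter.1 h).2
    by_cases hab : a < b
    · simp [hab, h.1]
    · simp [hab, h.1.not_gt]
  · rintro ⟨a, b⟩ h
    simp only [Finset.mem_filter, Finset.mem_univ, true_and] at h ⊢
    by_cases hab : ρ a < ρ b
    · simp [hab, h.1]
    · simp [hab, h.1.not_gt]

lemma exists_sum_tprod {n : ℕ} (x : Tens H n) :
    ∃ (m : ℕ) (c : Fin m → ℂ) (v : Fin m → Fin n → Cplx H),
      x = ∑ a, c a • PiTensorProduct.tprod ℂ (v a) := by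
  induction x using PiTensorProduct.induction_on with
  | smul_tprod r f => exact ⟨1, fun _ => r, fun _ => f, by simp⟩
  | add x y hx hy =>
    obtain ⟨m, c, v, rfl⟩ := hx
    obtain ⟨m', c', v', rfl⟩ := hy
    exact ⟨m + m', Fin.append c c', Fin.append v v', by simp [Fin.sum_univ_add]⟩

lemma qForm_self_nonneg (q : ℝ) (h1 : -1 ≤ q) (h2 : q ≤ 1) (n : ℕ) (x : Tens H n) :
    0 ≤ qForm H q n x x := by
  obtain ⟨m, c, v, rfl⟩ := exists_sum_tprod x
  let A : Fin m × Equiv.Perm (Fin n) → Fin m × Equiv.Perm (Fin n) → ℂ := fun a b =>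
    ∏ p ∈ Finset.univ.filter (fun p : Fin n × Fin n => p.1 < p.2),
      if (a.2 p.1 < a.2 p.2 ↔ b.2 p.1 < b.2 p.2) then (1 : ℂ) else (q : ℂ)
  let B : Fin m × Equiv.Perm (Fin n) → Fin m × Equiv.Perm (Fin n) → ℂ := fun a b =>
    ∏ j, bil H (conjC H (v a.1 (a.2 j))) (v b.1 (b.2 j))
  have hA : (Matrix.of A).PosSemidef :=
    posSemidef_prod (Finset.univ.filter (fun p : Fin n × Fin n => p.1 < p.2))
      (fun p (a b : Fin m × Equiv.Perm (Fin n)) =>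
        if (a.2 p.1 < a.2 p.2 ↔ b.2 p.1 < b.2 p.2) then (1 : ℂ) else (q : ℂ))
      (fun p _ => posSemidef_sign q h1 h2
        (fun a : Fin m × Equiv.Perm (Fin n) => a.2 p.1 < a.2 p.2))
  have hB : (Matrix.of B).PosSemidef :=
    posSemidef_prod Finset.univ
      (fun j (a b : Fin m × Equiv.Perm (Fin n)) =>
        bil H (conjC H (v a.1 (a.2 j))) (v b.1 (b.2 j)))
      (fun j _ => posSemidef_gram (fun a : Fin m × Equiv.Perm (Fin n) => v a.1 (a.2 j)))
  have h := (Matrix.posSemidef_iff_dotProduct_mulVec.1 (hA.hadamard hB)).2 (fun a => c a.1)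
  let G : Fin m → Fin m → ℂ := fun a b => ∑ σ : Equiv.Perm (Fin n),
    starRingEnd ℂ (c a) * ((q : ℂ) ^ inversions σ *
      (∏ j, bil H (conjC H (v a j)) (v b (σ j))) * c b)
  have hq : qForm H q n (∑ a, c a • PiTensorProduct.tprod ℂ (v a))
      (∑ a, c a • PiTensorProduct.tprod ℂ (v a)) = ∑ a, ∑ b, G a b := by
    simp only [map_sum, map_smulₛₗ, LinearMap.sum_apply, LinearMap.smul_apply, qForm_tprod,
      smul_eq_mul, RingHom.id_apply, G]
    simp only [Finset.mul_sum]
    rw [Finset.sum_comm]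
    refine Finset.sum_congr rfl fun a _ => Finset.sum_congr rfl fun b _ => ?_
    exact Finset.sum_congr rfl fun σ _ => by ring
  have hin : ∀ (a b : Fin m) (ρ : Equiv.Perm (Fin n)),
      ∑ τ : Equiv.Perm (Fin n), starRingEnd ℂ (c a) * (A (a, ρ) (b, τ) * B (a, ρ) (b, τ) * c b) =
        G a b := by
    intro a b ρ
    refine Fintype.sum_equiv (Equiv.mulRight ρ⁻¹) _ _ fun τ => ?_
    have e1 : B (a, ρ) (b, τ) = ∏ j, bil H (conjC H (v a j)) (v b ((τ * ρ⁻¹) j)) :=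
      Fintype.prod_equiv ρ _ _ fun j => by simp
    have e2 : A (a, ρ) (b, τ) = (q : ℂ) ^ inversions (τ * ρ⁻¹) :=
      (pow_inversions (q : ℂ) ρ τ).symm
    rw [e1, e2]
    rfl
  have hsum : star (fun a : Fin m × Equiv.Perm (Fin n) => c a.1) ⬝ᵥ
      ((Matrix.hadamard (Matrix.of A) (Matrix.of B)).mulVec fun a => c a.1) =
      (n.factorial : ℂ) * ∑ a, ∑ b, G a b := by
    simp only [dotProduct, Matrix.mulVec, Matrix.hadamard_apply, Matrix.of_apply,
      Fintype.sum_prod_type, Pi.star_apply, Finset.mul_sum]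
    refine Finset.sum_congr rfl fun a _ => ?_
    rw [Finset.sum_comm]
    refine Finset.sum_congr rfl fun b _ => ?_
    refine (Finset.sum_congr rfl fun ρ _ => hin a b ρ).trans ?_
    simp [Fintype.card_perm]
  rw [hsum, ← hq] at h
  have hn : (0 : ℂ) ≤ ((n.factorial : ℝ)⁻¹ : ℝ) := by exact_mod_cast (by positivity)
  have hn' : (((n.factorial : ℝ)⁻¹ : ℝ) : ℂ) * (n.factorial : ℂ) = 1 := by
    have : (n.factorial : ℝ) ≠ 0 := by positivity
    exact_mod_cast inv_mul_cancel₀ this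
  have h' := mul_nonneg hn h
  rwa [← mul_assoc, hn', one_mul] at h'

end Positivity

end Tensors

/-! ### The `q`-Fock space -/

section Fock

variable (q : Set.Ioo (-1 : ℝ) 1) (H : Type*) [NormedAddCommGroup H] [InnerProductSpace ℝ H]

/-- The algebraic Fock space `𝓕(H) = ⨁ₙ H_ℂ^{⊗ n}`, an algebra under concatenation of
tensors, whose unit is the vacuum vector. -/
abbrev AlgFock : Type _ := ⨁ n : ℕ, Tens H n

/-- The algebraic Fock space as a pre-Hilbert space with the `q`-deformed inner product. -/
def QFock (_q : Set.Ioo (-1 : ℝ) 1) (H : Type*) [NormedAddCommGroup H] [InnerProductSpace ℝ H] :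
    Type _ := AlgFock H

/-- The `q`-deformed form on the algebraic Fock space: different degrees are orthogonal and
degree `n` carries `qForm`. -/
def fockForm (ξ η : AlgFock H) : ℂ :=
  DirectSum.toModule ℂ ℕ ℂ (fun n => qForm H q n (ξ n)) η

variable {H}

lemma fockForm_of (ξ : AlgFock H) (n : ℕ) (y : Tens H n) :
    fockForm q H ξ (DirectSum.of (fun n => Tens H n) n y) = qForm H q n (ξ n) y := by
  rw [fockForm, ← DirectSum.lof_eq_of ℂ, DirectSum.toModule_lof]

lemma fockForm_add_right (ξ η η' : AlgFock H) :
    fockForm q H ξ (η + η') = fockForm q H ξ η + fockForm q H ξ η' := map_add _ _ _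

lemma fockForm_add_left (ξ ξ' η : AlgFock H) :
    fockForm q H (ξ + ξ') η = fockForm q H ξ η + fockForm q H ξ' η := by
  induction η using DirectSum.induction_on with
  | zero => simp [fockForm]
  | of n y => simp only [fockForm_of, DirectSum.add_apply, map_add, LinearMap.add_apply]
  | add y y' hy hy' => simp only [fockForm_add_right, hy, hy']; ring

lemma fockForm_smul_left (c : ℂ) (ξ η : AlgFock H) :
    fockForm q H (c • ξ) η = starRingEnd ℂ c * fockForm q H ξ η := by
  induction η using DirectSum.induction_on with
  | zero => simp [fockForm]
  | of n y =>
    simp only [fockForm_of, DirectSum.smul_apply, map_smulₛₗ, LinearMap.smul_apply, smul_eq_mul]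
  | add y y' hy hy' => simp only [fockForm_add_right, hy, hy']; ring

lemma fockForm_conj_symm (ξ η : AlgFock H) :
    starRingEnd ℂ (fockForm q H η ξ) = fockForm q H ξ η := by
  induction η using DirectSum.induction_on with
  | zero =>
    have := fockForm_smul_left q 0 0 ξ
    rw [zero_smul, map_zero, zero_mul] at this
    rw [this]; simp [fockForm]
  | add y y' hy hy' => simp only [fockForm_add_right, fockForm_add_left, map_add, hy, hy']
  | of n y =>
    induction ξ using DirectSum.induction_on with
    | zero =>
      have := fockForm_smul_left q 0 0 (DirectSum.of (fun n => Tens H n) n y)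
      rw [zero_smul, map_zero, zero_mul] at this
      rw [this]; simp [fockForm]
    | add x x' hx hx' => simp only [fockForm_add_right, fockForm_add_left, map_add, hx, hx']
    | of m x =>
      rw [fockForm_of, fockForm_of]
      by_cases h : m = n
      · subst h
        rw [DirectSum.of_eq_same, DirectSum.of_eq_same, qForm_conj_symm]
      · rw [DirectSum.of_eq_of_ne _ _ _ h, DirectSum.of_eq_of_ne _ _ _ (Ne.symm h)]
        simp

lemma fockForm_self_nonneg (ξ : AlgFock H) : 0 ≤ (fockForm q H ξ ξ).re := by
  classical
  have h : fockForm q H ξ ξ = ∑ n ∈ DFinsupp.support ξ, qForm H q n (ξ n) (ξ n) := by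
    conv_lhs => rw [← DirectSum.sum_support_of ξ]
    rw [fockForm, map_sum]
    refine Finset.sum_congr rfl fun n _ => ?_
    rw [DirectSum.sum_support_of ξ]
    exact fockForm_of q ξ n (ξ n)
  rw [h, Complex.re_sum]
  exact Finset.sum_nonneg fun n _ =>
    (Complex.le_def.1 (qForm_self_nonneg (q : ℝ) q.2.1.le q.2.2.le n (ξ n))).1

variable (H)

/-- The `q`-deformed pre-inner product on the algebraic Fock space. -/
abbrev fockCore : PreInnerProductSpace.Core ℂ (AlgFock H) where
  inner ξ η := fockForm q H ξ η
  conj_inner_symm ξ η := fockForm_conj_symm q ξ η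
  re_inner_nonneg ξ := fockForm_self_nonneg q ξ
  add_left ξ ξ' η := fockForm_add_left q ξ ξ' η
  smul_left ξ η c := fockForm_smul_left q c ξ η

instance : SeminormedAddCommGroup (QFock q H) :=
  @InnerProductSpace.Core.toSeminormedAddCommGroup ℂ (AlgFock H) _ _ _ (fockCore q H)

instance : InnerProductSpace ℂ (QFock q H) :=
  @InnerProductSpace.ofCore ℂ (AlgFock H) _ _ _ (fockCore q H)

/-- The `q`-Fock space `𝓕_q(H)`, the Hilbert space completion of the algebraic Fock space. -/
abbrev Fock : Type _ := UniformSpace.Completion (QFock q H)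

variable {H}

/-- The canonical map `𝓕(H) → 𝓕_q(H)`. -/
def vec (ξ : AlgFock H) : Fock q H := ((show QFock q H from ξ) : UniformSpace.Completion (QFock q H))

/-- The vacuum vector `Ω`. -/
def vacuum (H : Type*) [NormedAddCommGroup H] [InnerProductSpace ℝ H] : Fock q H :=
  vec q (1 : AlgFock H)

/-- A vector `h ∈ H` as an element of degree one of the algebraic Fock space. -/
def letter (h : H) : AlgFock H :=
  DirectSum.of (fun n => Tens H n) 1 (PiTensorProduct.tprod ℂ fun _ => (1 : ℂ) ⊗ₜ[ℝ] h)

/-- The bounded operator `L` on `𝓕_q(H)` is the left creation operator `l_q(h)`, determined by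
`l_q(h) (h₁ ⊗ ⋯ ⊗ hₙ) = h ⊗ h₁ ⊗ ⋯ ⊗ hₙ`. -/
def IsCreation (h : H) (L : Fock q H →L[ℂ] Fock q H) : Prop :=
  ∀ ξ : AlgFock H, L (vec q ξ) = vec q (letter h * ξ)

variable (H)

/-- The `q`-Gaussian von Neumann algebra `Γ_q(H) = {s_q(h) | h ∈ H}''`, the double commutant of
the self-adjoint operators `s_q(h) = l_q(h) + l_q(h)^*`. -/
def gaussianAlgebra : Set (Fock q H →L[ℂ] Fock q H) :=
  Set.centralizer (Set.centralizer
    {s | ∃ (h : H) (L : Fock q H →L[ℂ] Fock q H), IsCreation q h L ∧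
      s = L + ContinuousLinearMap.adjoint L})

/-- `W` is the Wick product map: for each `ξ ∈ 𝓕(H)`, `W ξ` is the one and only element `x` of
`Γ_q(H)` with `x Ω = ξ`. -/
def IsWickMap (W : AlgFock H →ₗ[ℂ] (Fock q H →L[ℂ] Fock q H)) : Prop :=
  ∀ (ξ : AlgFock H) (x : Fock q H →L[ℂ] Fock q H),
    (x ∈ gaussianAlgebra q H ∧ x (vacuum q H) = vec q ξ) ↔ x = W ξ

end Fock

/-! ### The maps `R*`, `v`, `w` and `β` -/

section Maps

variable (q : ℝ) (H : Type*) [NormedAddCommGroup H] [InnerProductSpace ℝ H]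

/-- The number of inversions of the shuffle listing first the elements of `S` and then those of
its complement, both in increasing order. -/
def shuffleInversions {n : ℕ} (S : Finset (Fin n)) : ℕ :=
  ((S ×ˢ Sᶜ).filter fun p => p.2 < p.1).card

/-- The linear map `h₁ ⊗ ⋯ ⊗ hₙ ↦ ξ_S ⊗ ξ_{Sᶜ}`, where `ξ_S` is the tensor of the letters with
index in `S`, in increasing order. -/
def split {n a b : ℕ} (S : Finset (Fin n)) (hS : S.card = a) (hS' : Sᶜ.card = b) :
    Tens H n →ₗ[ℂ] Tens H a ⊗[ℂ] Tens H b :=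
  (PiTensorProduct.tmulEquiv ℂ (Cplx H)).symm.toLinearMap ∘ₗ
    (PiTensorProduct.reindex ℂ (fun _ => Cplx H) (finSumEquivOfFinset hS hS').symm).toLinearMap

/-- For `n = a + b`, the map `R*_{n,b} : H_ℂ^{⊗ n} → H_ℂ^{⊗ a} ⊗ H_ℂ^{⊗ b}`,
`ξ ↦ ∑_S q^{ι(S)} ξ_S ⊗ ξ_{Sᶜ}`, the sum being over the `S ⊆ {1, …, n}` with `a` elements (the
complement having `b` elements). It is `0` if `n ≠ a + b`. -/
def rStar (n a b : ℕ) : Tens H n →ₗ[ℂ] Tens H a ⊗[ℂ] Tens H b :=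
  ∑ S : {S : Finset (Fin n) // S.card = a ∧ Sᶜ.card = b},
    ((q : ℂ) ^ shuffleInversions S.1) • split H S.1 S.2.1 S.2.2

/-- The map `Id_a ⊗ m_j ⊗ Id_b`, with `m_j` the `q`-deformed duality pairing of
`H_ℂ^{⊗ j}` with itself. -/
def contractMid (a j b : ℕ) :
    (Tens H a ⊗[ℂ] Tens H j) ⊗[ℂ] (Tens H j ⊗[ℂ] Tens H b) →ₗ[ℂ] Tens H a ⊗[ℂ] Tens H b :=
  LinearMap.lTensor (Tens H a)
      ((TensorProduct.lid ℂ (Tens H b)).toLinearMap ∘ₗ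
        LinearMap.rTensor (Tens H b) (TensorProduct.lift (qPairing H q j)) ∘ₗ
        (TensorProduct.assoc ℂ (Tens H j) (Tens H j) (Tens H b)).symm.toLinearMap) ∘ₗ
    (TensorProduct.assoc ℂ (Tens H a) (Tens H j) (Tens H j ⊗[ℂ] Tens H b)).toLinearMap

variable {H} {B : Type*} [Ring B] [Algebra ℂ B] (W : AlgFock H →ₗ[ℂ] B)

/-- The map `v_{a+b,b} : ξ ⊗ η ↦ W(ξ) W(η)` on `H_ℂ^{⊗ a} ⊗ H_ℂ^{⊗ b}`. -/
def vMap (a b : ℕ) : Tens H a ⊗[ℂ] Tens H b →ₗ[ℂ] B :=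
  LinearMap.mul' ℂ B ∘ₗ
    TensorProduct.map (W ∘ₗ DirectSum.lof ℂ ℕ (fun n => Tens H n) a)
      (W ∘ₗ DirectSum.lof ℂ ℕ (fun n => Tens H n) b)

/-- The map `w^j_{n,k} = v_{n-2j,k-j} ∘ (Id_{n-k-j} ⊗ m_j ⊗ Id_{k-j}) ∘
(R*_{n-k,j} ⊗ R*_{k,k-j})` on `H_ℂ^{⊗ (n-k)} ⊗ H_ℂ^{⊗ k}`. It is `0` if `j > n - k` or
`j > k`. -/
def wMap (n k j : ℕ) : Tens H (n - k) ⊗[ℂ] Tens H k →ₗ[ℂ] B :=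
  vMap W (n - k - j) (k - j) ∘ₗ contractMid q H (n - k - j) j (k - j) ∘ₗ
    TensorProduct.map (rStar q H (n - k) (n - k - j) j) (rStar q H k j (k - j))

/-- The map `β_{n,k}` on `H_ℂ^{⊗ (n-k)} ⊗ H_ℂ^{⊗ k}`,
`(h₁ ⊗ ⋯ ⊗ h_{n-k}) ⊗ (h_{n-k+1} ⊗ ⋯ ⊗ hₙ) ↦ W(h₁ ⊗ ⋯ ⊗ hₙ)`. -/
def betaMap (n k : ℕ) : Tens H (n - k) ⊗[ℂ] Tens H k →ₗ[ℂ] B :=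
  W ∘ₗ LinearMap.mul' ℂ (AlgFock H) ∘ₗ
    TensorProduct.map (DirectSum.lof ℂ ℕ (fun n => Tens H n) (n - k))
      (DirectSum.lof ℂ ℕ (fun n => Tens H n) k)

end Maps

end QGaussian

end

/-! The algebraic Fock space is the free algebra on H_ℂ (`gen`). On it left annihilation ∂_h
(`annih`) is a twisted derivation, ∂_h(ξη) = (∂_h ξ)η + (q^N ξ)(∂_h η), where q^N is `qNumber`. A
Wick map satisfies W(hξ) = s(h) W(ξ) − W(∂_h ξ), because both sides lie in the Gaussian algebra and
send Ω to h ⊗ ξ. Together with W(1) = 1 this recursion is all that the formula needs to know about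
W.

The maps R* of all degrees assemble into Δ (`coprod`), which obeys Δ(xξ) = (x ⊗ 1 + q^N ⊗ x) Δξ. The
alternating sum of the w^j is C(Δξ ⊗ Δη), where C (`contraction`) pairs the two inner legs with
weights c_j = (−1)^j q^(j choose 2), so the claim becomes C(Δξ ⊗ Δη) = W(ξη) (`contraction_coprod`).
The letters of ξ are created one at a time. In Δ(hξ) the new letter may join the outer leg, where
the recursion for W produces s(h) and a term −∂_h. Or it joins the inner leg, where it is adjoint to
∂_h acting on η, and c_{j+1} = −q^j c_j makes the result minus the contraction of q^N ξ with ∂_h η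
(`contraction_braidedMul`). Since Δ intertwines ∂_h with ∂_h ⊗ 1 (`coprod_annih`), the Leibniz rule
merges the two corrections into −W(∂_h(ξη)).

For existence and uniqueness of W, creation operators are bounded (`norm_sq_vec_letter_mul_le`), and
the right Gaussian operators commute with the left ones (`IsCreation.commute_right`), which makes Ω
separating. Vectors are reached from Ω by the same recursion. Throughout, `mem_of_letter_mul_mem` is
the induction principle: a step to hξ may use both ξ and ∂_h ξ. -/

noncomputable section

namespace QGaussian

/-! ### The Fock space as a free algebra: annihilation, number operator, reversal. -/

section FreeAlgebra

variable {H : Type*} [NormedAddCommGroup H] [InnerProductSpace ℝ H]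

/-- The inclusion of `H_ℂ` into the algebraic Fock space as the vectors of degree one. -/
def gen : Cplx H →ₗ[ℂ] AlgFock H :=
  TensorAlgebra.equivDirectSum.toLinearMap ∘ₗ TensorAlgebra.ι ℂ

lemma gen_eq (x : Cplx H) :
    gen x = DirectSum.of (fun n => Tens H n) 1 (PiTensorProduct.tprod ℂ fun _ => x) := by
  simp [gen, TensorAlgebra.equivDirectSum_apply]

lemma letter_eq_gen (h : H) : letter h = gen ((1 : ℂ) ⊗ₜ[ℝ] h) := (gen_eq _).symm

/-- The universal property of the algebraic Fock space as a free algebra over `H_ℂ`. -/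
def liftGen {A : Type*} [Semiring A] [Algebra ℂ A] (f : Cplx H →ₗ[ℂ] A) : AlgFock H →ₐ[ℂ] A :=
  (TensorAlgebra.lift ℂ f).comp TensorAlgebra.equivDirectSum.symm.toAlgHom

@[simp] lemma liftGen_gen {A : Type*} [Semiring A] [Algebra ℂ A] (f : Cplx H →ₗ[ℂ] A) (x : Cplx H) :
    liftGen f (gen x) = f x := by
  have : TensorAlgebra.equivDirectSum.symm (gen x) = TensorAlgebra.ι ℂ x :=
    TensorAlgebra.equivDirectSum.symm_apply_apply _
  change TensorAlgebra.lift ℂ f (TensorAlgebra.equivDirectSum.symm (gen x)) = _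
  rw [this, TensorAlgebra.lift_ι_apply]

lemma of_tprod {n : ℕ} (v : Fin n → Cplx H) :
    DirectSum.of (fun n => Tens H n) n (PiTensorProduct.tprod ℂ v) =
      (List.ofFn fun i => gen (v i)).prod := by
  rw [← TensorAlgebra.toDirectSum_tensorPower_tprod, TensorAlgebra.tprod_apply, map_list_prod,
    List.map_ofFn]
  rfl

lemma of_tprod_cons {n : ℕ} (x : Cplx H) (v : Fin n → Cplx H) :
    DirectSum.of (fun n => Tens H n) (n + 1) (PiTensorProduct.tprod ℂ (Fin.cons x v)) =
      gen x * DirectSum.of (fun n => Tens H n) n (PiTensorProduct.tprod ℂ v) := by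
  simp [of_tprod, List.ofFn_succ]

lemma of_tprod_zero (v : Fin 0 → Cplx H) :
    DirectSum.of (fun n => Tens H n) 0 (PiTensorProduct.tprod ℂ v) = 1 := by
  simp [of_tprod]

lemma mem_of_tprod_mem {p : Submodule ℂ (AlgFock H)}
    (hp : ∀ (n : ℕ) (v : Fin n → Cplx H),
      DirectSum.of (fun n => Tens H n) n (PiTensorProduct.tprod ℂ v) ∈ p) (ξ : AlgFock H) :
    ξ ∈ p := by
  induction ξ using DirectSum.induction_on with
  | zero => exact p.zero_mem
  | add x y hx hy => exact p.add_mem hx hy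
  | of n x =>
    induction x using PiTensorProduct.induction_on with
    | add x y hx hy => rw [map_add]; exact p.add_mem hx hy
    | smul_tprod r v =>
      rw [← DirectSum.lof_eq_of ℂ, map_smul]
      exact p.smul_mem r (hp n v)

lemma mem_of_gen_mul_mem {p : Submodule ℂ (AlgFock H)} (h1 : 1 ∈ p)
    (hm : ∀ (x : Cplx H), ∀ ξ ∈ p, gen x * ξ ∈ p) (ξ : AlgFock H) : ξ ∈ p := by
  refine mem_of_tprod_mem (fun n v => ?_) ξ
  induction n with
  | zero => rwa [of_tprod_zero]
  | succ n ih =>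
    rw [← Fin.cons_self_tail v, of_tprod_cons]
    exact hm _ _ (ih _)

lemma gen_mul_mem_of_letter_mul_mem {p : Submodule ℂ (AlgFock H)} {ξ : AlgFock H}
    (hm : ∀ h : H, letter h * ξ ∈ p) (x : Cplx H) : gen x * ξ ∈ p := by
  induction x using TensorProduct.induction_on with
  | zero => simp
  | add x y hx hy => rw [map_add, add_mul]; exact p.add_mem hx hy
  | tmul z h =>
    have : z ⊗ₜ[ℝ] h = z • ((1 : ℂ) ⊗ₜ[ℝ] h) := by simp [TensorProduct.smul_tmul']
    rw [this, map_smul, smul_mul_assoc, ← letter_eq_gen]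
    exact p.smul_mem _ (hm h)

/-- Induction on words, in the form used for most operator identities: an identity of linear maps
propagates by adding one letter on the left. -/
lemma linearMap_ext_gen_mul {M : Type*} [AddCommMonoid M] [Module ℂ M] {f g : AlgFock H →ₗ[ℂ] M}
    (h1 : f 1 = g 1) (hm : ∀ (x : Cplx H) (ξ), f ξ = g ξ → f (gen x * ξ) = g (gen x * ξ)) :
    f = g :=
  LinearMap.ext fun ξ => mem_of_gen_mul_mem (p := LinearMap.eqLocus f g) h1 hm ξ

/-- The number operator exponentiated: multiplication by `q ^ n` in degree `n`. -/
def qNumber (q : ℂ) : AlgFock H →ₐ[ℂ] AlgFock H := liftGen (q • gen)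

@[simp] lemma qNumber_gen (q : ℂ) (x : Cplx H) : qNumber q (gen x) = q • gen x := by
  simp [qNumber]

lemma qNumber_of (q : ℂ) (n : ℕ) (x : Tens H n) :
    qNumber q (DirectSum.of (fun n => Tens H n) n x) =
      q ^ n • DirectSum.of (fun n => Tens H n) n x := by
  induction x using PiTensorProduct.induction_on with
  | add x y hx hy => rw [map_add, map_add, hx, hy, smul_add]
  | smul_tprod r v =>
    rw [← DirectSum.lof_eq_of ℂ, map_smul, map_smul, DirectSum.lof_eq_of, smul_comm]
    congr 1
    induction n with
    | zero => rw [of_tprod_zero]; simp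
    | succ n ih =>
      rw [← Fin.cons_self_tail v, of_tprod_cons, map_mul, ih, qNumber_gen, smul_mul_smul_comm,
        pow_succ']

/-- Left annihilation `h₁ ⊗ ⋯ ⊗ hₙ ↦ ∑ᵢ q^(i-1) ⟨x, hᵢ⟩ h₁ ⊗ ⋯ ⊗ ĥᵢ ⊗ ⋯ ⊗ hₙ`, read off from the
second component of the algebra homomorphism below applied to `(1, 0)`. -/
def annihHom (q : ℂ) (x : Cplx H) : AlgFock H →ₐ[ℂ] Module.End ℂ (AlgFock H × AlgFock H) :=
  liftGen
    -- Annihilation is not multiplicative, but its recursion is the action of lower triangular 2 × 2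
    -- matrices, to which the universal property applies. The first component remembers the word
    -- processed so far.
    { toFun := fun y =>
        (LinearMap.mulLeft ℂ (gen y) ∘ₗ LinearMap.fst ℂ _ _).prod
          (bil H x y • LinearMap.fst ℂ _ _ +
            q • (LinearMap.mulLeft ℂ (gen y) ∘ₗ LinearMap.snd ℂ _ _))
      map_add' := fun y z => by
        refine LinearMap.ext fun a => Prod.ext ?_ ?_
        · simp [add_mul]
        · simp [add_mul, add_smul, smul_add]; abel
      map_smul' := fun c y => by
        refine LinearMap.ext fun a => Prod.ext ?_ ?_
        · simp
        · simp [smul_smul, mul_comm] }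

/-- Left annihilation by `x` on the algebraic Fock space. -/
def annih (q : ℂ) (x : Cplx H) : AlgFock H →ₗ[ℂ] AlgFock H where
  toFun ξ := (annihHom q x ξ (1, 0)).2
  map_add' ξ η := by simp
  map_smul' c ξ := by simp

lemma annihHom_apply_fst (q : ℂ) (x : Cplx H) (ξ : AlgFock H) :
    (annihHom q x ξ (1, 0)).1 = ξ := by
  let f : AlgFock H →ₗ[ℂ] AlgFock H :=
    { toFun := fun ξ => (annihHom q x ξ (1, 0)).1
      map_add' := fun ξ η => by simp
      map_smul' := fun c ξ => by simp }
  have : f = LinearMap.id := by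
    refine linearMap_ext_gen_mul ?_ fun y ξ h => ?_
    · simp [f]
    · change (annihHom q x (gen y * ξ) (1, 0)).1 = gen y * ξ
      rw [map_mul, Module.End.mul_apply]
      have h' : (annihHom q x ξ (1, 0)).1 = ξ := h
      rw [annihHom, liftGen_gen]
      rw [annihHom] at h'
      simp [h']
  exact LinearMap.congr_fun this ξ

@[simp] lemma annih_one (q : ℂ) (x : Cplx H) : annih q x 1 = 0 := by
  simp [annih]

lemma annih_gen_mul (q : ℂ) (x y : Cplx H) (ξ : AlgFock H) :
    annih q x (gen y * ξ) = bil H x y • ξ + q • (gen y * annih q x ξ) := by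
  have h := annihHom_apply_fst q x ξ
  change (annihHom q x (gen y * ξ) (1, 0)).2 = _ + q • (gen y * (annihHom q x ξ (1, 0)).2)
  rw [map_mul, Module.End.mul_apply]
  conv_lhs => enter [1, 1]; rw [annihHom, liftGen_gen]
  simp [h]

/-- The twisted Leibniz rule: passing each letter costs a factor q, so passing all of ξ costs q^N ξ.
-/
lemma annih_mul (q : ℂ) (x : Cplx H) (ξ η : AlgFock H) :
    annih q x (ξ * η) = annih q x ξ * η + qNumber q ξ * annih q x η := by
  have : annih q x ∘ₗ LinearMap.mulRight ℂ η =
      LinearMap.mulRight ℂ η ∘ₗ annih q x +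
        LinearMap.mulRight ℂ (annih q x η) ∘ₗ (qNumber q).toLinearMap := by
    refine linearMap_ext_gen_mul (by simp) fun y ξ h => ?_
    simp only [LinearMap.comp_apply, LinearMap.mulRight_apply, LinearMap.add_apply,
      AlgHom.toLinearMap_apply] at h ⊢
    rw [mul_assoc, annih_gen_mul, h, annih_gen_mul, map_mul, qNumber_gen, add_mul, mul_add,
      smul_add, ← mul_assoc, smul_mul_assoc, smul_mul_assoc, smul_mul_assoc, smul_mul_assoc,
      mul_assoc, mul_assoc, add_assoc]
  exact LinearMap.congr_fun this ξ

lemma annih_gen (q : ℂ) (x y : Cplx H) : annih q x (gen y) = bil H x y • 1 := by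
  simpa using annih_gen_mul q x y 1

/-- Annihilations and creations suffice to reach every vector from the vacuum: the largest
subspace of `p` stable under annihilation is stable under creation. -/
lemma mem_of_letter_mul_mem (q : ℂ) {p : Submodule ℂ (AlgFock H)} (h1 : 1 ∈ p)
    (hm : ∀ (h : H), ∀ ξ ∈ p, annih q ((1 : ℂ) ⊗ₜ h) ξ ∈ p → letter h * ξ ∈ p) (ξ : AlgFock H) :
    ξ ∈ p := by
  let d : AlgFock H → H → AlgFock H := fun ξ h => annih q ((1 : ℂ) ⊗ₜ h) ξ
  have dadd : ∀ (l : List H) (ξ η), l.foldl d (ξ + η) = l.foldl d ξ + l.foldl d η := by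
    intro l
    induction l with
    | nil => simp
    | cons h l ih => intro ξ η; simp only [List.foldl_cons, d, map_add]; exact ih _ _
  have dsmul : ∀ (l : List H) (c : ℂ) (ξ), l.foldl d (c • ξ) = c • l.foldl d ξ := by
    intro l
    induction l with
    | nil => simp
    | cons h l ih => intro c ξ; simp only [List.foldl_cons, d, map_smul]; exact ih _ _
  let p' : Submodule ℂ (AlgFock H) :=
    { carrier := {ξ | ∀ l : List H, l.foldl d ξ ∈ p}
      add_mem' := fun {a b} ha hb l => by rw [dadd]; exact p.add_mem (ha l) (hb l)
      zero_mem' := fun l => by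
        have := dsmul l 0 0
        rw [zero_smul, zero_smul] at this
        rw [this]; exact p.zero_mem
      smul_mem' := fun c a ha l => by rw [dsmul]; exact p.smul_mem c (ha l) }
  -- An annihilation word is moved past `letter h` by the q-commutation relation. Each move leaves a
  -- scalar term in ξ and a term with ξ replaced by one of its annihilations, hence the
  -- quantification over ξ.
  have step : ∀ (l : List H) (h : H) (ξ), ξ ∈ p' → l.foldl d (letter h * ξ) ∈ p := by
    intro l
    induction l with
    | nil => exact fun h ξ hξ => hm h ξ (hξ []) (hξ [h])
    | cons k l ih =>
      intro h ξ hξ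
      simp only [List.foldl_cons]
      change l.foldl d (annih q _ _) ∈ p
      rw [letter_eq_gen, annih_gen_mul, dadd, dsmul, dsmul, ← letter_eq_gen]
      exact p.add_mem (p.smul_mem _ (hξ l))
        (p.smul_mem _ (ih h _ fun l' => hξ (k :: l')))
  have h1' : (1 : AlgFock H) ∈ p' := fun l => by
    cases l with
    | nil => exact h1
    | cons h l =>
      simp only [List.foldl_cons]
      change l.foldl d (annih q _ 1) ∈ p
      have := dsmul l 0 0
      rw [zero_smul, zero_smul] at this
      rw [annih_one, this]; exact p.zero_mem
  exact mem_of_gen_mul_mem h1'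
    (fun x ξ hξ => gen_mul_mem_of_letter_mul_mem (p := p') (fun h l => step l h ξ hξ) x) ξ []

/-- Annihilation lowers the degree, so it is locally nilpotent. The nilpotency order is the
induction parameter of the norm estimate for creation operators. -/
lemma exists_iterate_annih_eq_zero (q : ℂ) (x : Cplx H) (ξ : AlgFock H) :
    ∃ n, ((annih q x) ^ n) ξ = 0 := by
  have mono : ∀ {m n : ℕ} {ξ : AlgFock H}, m ≤ n → ((annih q x) ^ m) ξ = 0 →
      ((annih q x) ^ n) ξ = 0 := by
    intro m n ξ hmn h
    obtain ⟨k, rfl⟩ := Nat.exists_eq_add_of_le' hmn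
    rw [pow_add, Module.End.mul_apply, h, map_zero]
  have step : ∀ (n : ℕ) (y : Cplx H) (ξ : AlgFock H), ((annih q x) ^ n) ξ = 0 →
      ((annih q x) ^ (n + 1)) (gen y * ξ) = 0 := by
    intro n y
    induction n with
    | zero => intro ξ h; simp [show ξ = 0 by simpa using h]
    | succ n ih =>
      intro ξ h
      rw [pow_succ, Module.End.mul_apply, annih_gen_mul, map_add, map_smul, map_smul, h,
        ih _ (by rwa [pow_succ, Module.End.mul_apply] at h)]
      simp
  let p : Submodule ℂ (AlgFock H) :=
    { carrier := {ξ | ∃ n, ((annih q x) ^ n) ξ = 0}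
      add_mem' := fun {a b} ⟨m, ha⟩ ⟨n, hb⟩ => ⟨max m n, by
        rw [map_add, mono (le_max_left _ _) ha, mono (le_max_right _ _) hb, add_zero]⟩
      zero_mem' := ⟨0, by simp⟩
      smul_mem' := fun c a ⟨n, h⟩ => ⟨n, by rw [map_smul, h, smul_zero]⟩ }
  exact mem_of_gen_mul_mem (p := p) ⟨1, by simp⟩ (fun y ξ ⟨n, h⟩ => ⟨n + 1, step n y ξ h⟩) ξ

/-- The reversal of words, an anti-automorphism of the algebraic Fock space. -/
def revHom : AlgFock H →ₐ[ℂ] (AlgFock H)ᵐᵒᵖ :=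
  liftGen ((MulOpposite.opLinearEquiv ℂ).toLinearMap ∘ₗ gen)

/-- The reversal of words as a linear map. -/
def rev : AlgFock H →ₗ[ℂ] AlgFock H :=
  (MulOpposite.opLinearEquiv ℂ).symm.toLinearMap ∘ₗ revHom.toLinearMap

@[simp] lemma rev_one : rev (1 : AlgFock H) = 1 := by simp [rev]

@[simp] lemma rev_gen (x : Cplx H) : rev (gen x) = gen x := by simp [rev, revHom]

lemma rev_mul (ξ η : AlgFock H) : rev (ξ * η) = rev η * rev ξ := by simp [rev]

@[simp] lemma rev_rev (ξ : AlgFock H) : rev (rev ξ) = ξ := by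
  have : rev ∘ₗ rev = (LinearMap.id : AlgFock H →ₗ[ℂ] AlgFock H) := by
    refine linearMap_ext_gen_mul (by simp) fun x ξ h => ?_
    simp only [LinearMap.comp_apply, LinearMap.id_apply] at h ⊢
    rw [rev_mul, rev_mul, rev_gen, rev_gen, h]
  exact LinearMap.congr_fun this ξ

lemma rev_of_tprod {n : ℕ} (v : Fin n → Cplx H) :
    rev (DirectSum.of (fun n => Tens H n) n (PiTensorProduct.tprod ℂ v)) =
      DirectSum.of (fun n => Tens H n) n (PiTensorProduct.tprod ℂ (v ∘ Fin.rev)) := by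
  have key : ∀ l : List (Cplx H), rev (l.map gen).prod = (l.reverse.map gen).prod := by
    intro l
    induction l with
    | nil => simp
    | cons x l ih => simp [rev_mul, ih]
  have h := key (List.ofFn v)
  rw [of_tprod, of_tprod]
  have hr : (List.ofFn v).reverse = List.ofFn (v ∘ Fin.rev) := by
    refine List.ext_getElem (by simp) fun i _ _ => ?_
    simp only [List.getElem_reverse, List.getElem_ofFn, List.length_ofFn, Function.comp_apply]
    congr 1
    ext
    simp only [Fin.val_rev]
    omega
  rw [hr, List.map_ofFn, List.map_ofFn] at h
  exact h

lemma qNumber_rev (q : ℂ) (ξ : AlgFock H) : qNumber q (rev ξ) = rev (qNumber q ξ) := by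
  have : (qNumber q).toLinearMap ∘ₗ rev = rev ∘ₗ (qNumber q : AlgFock H →ₐ[ℂ] _).toLinearMap := by
    refine linearMap_ext_gen_mul (by simp) fun x ξ h => ?_
    simp only [LinearMap.comp_apply, AlgHom.toLinearMap_apply] at h ⊢
    rw [rev_mul, map_mul, map_mul, h, rev_mul, rev_gen, qNumber_gen, map_smul, rev_gen]
  exact LinearMap.congr_fun this ξ

/-- Right annihilation commutes with left creation up to the vacuum term. -/
lemma rev_annih_rev_gen_mul (q : ℂ) (x y : Cplx H) (ξ : AlgFock H) :
    rev (annih q x (rev (gen y * ξ))) =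
      gen y * rev (annih q x (rev ξ)) + bil H x y • qNumber q ξ := by
  rw [rev_mul, annih_mul, rev_gen, annih_gen, map_add, rev_mul, rev_gen, qNumber_rev]
  simp

end FreeAlgebra


/-! ### Inversions of permutations, split at the first point. -/

section Permutations

/-- The permutation of `Fin (n + 1)` sending `0` to `i` and acting as `e` on the other points, via
the order-preserving identifications. -/
def consPerm {n : ℕ} (i : Fin (n + 1)) (e : Equiv.Perm (Fin n)) : Equiv.Perm (Fin (n + 1)) :=
  ((finSuccEquiv' 0).trans (Equiv.optionCongr e)).trans (finSuccEquiv' i).symm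

@[simp] lemma consPerm_zero {n : ℕ} (i : Fin (n + 1)) (e : Equiv.Perm (Fin n)) :
    consPerm i e 0 = i := by
  simp [consPerm]

@[simp] lemma consPerm_succ {n : ℕ} (i : Fin (n + 1)) (e : Equiv.Perm (Fin n)) (j : Fin n) :
    consPerm i e j.succ = i.succAbove (e j) := by
  have h : finSuccEquiv' (0 : Fin (n + 1)) j.succ = some j := by
    rw [← Fin.zero_succAbove, finSuccEquiv'_succAbove]
  simp [consPerm, h]

lemma consPerm_bijective (n : ℕ) :
    Function.Bijective fun p : Fin (n + 1) × Equiv.Perm (Fin n) => consPerm p.1 p.2 := by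
  rw [Fintype.bijective_iff_injective_and_card]
  constructor
  · rintro ⟨i, e⟩ ⟨i', e'⟩ h
    have h0 : i = i' := by simpa using Equiv.congr_fun h 0
    subst h0
    congr 1
    ext1 j
    simpa using Equiv.congr_fun h j.succ
  · simp [Fintype.card_perm, Nat.factorial_succ]

lemma inversions_eq_sum {n : ℕ} (σ : Equiv.Perm (Fin n)) :
    inversions σ = ∑ a, ∑ b, if a < b ∧ σ b < σ a then 1 else 0 := by
  rw [inversions, Finset.card_filter, ← Finset.univ_product_univ, Finset.sum_product]

/-- The first point is inverted exactly with the `i` points whose images lie below `i`; inversions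
among the others are those of `e`, since `succAbove` is increasing. -/
lemma inversions_consPerm {n : ℕ} (i : Fin (n + 1)) (e : Equiv.Perm (Fin n)) :
    inversions (consPerm i e) = i + inversions e := by
  simp only [inversions_eq_sum, Fin.sum_univ_succ, consPerm_zero, consPerm_succ,
    false_and, if_false, zero_add, Fin.succ_pos, true_and, Fin.not_lt_zero,
    Fin.succ_lt_succ_iff, (Fin.strictMono_succAbove i).lt_iff_lt]
  congr 1
  rw [Equiv.sum_comp e fun b => if i.succAbove b < i then 1 else 0]
  simp only [Fin.succAbove_lt_iff_castSucc_lt]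
  simp only [Fin.lt_def, Fin.val_castSucc]
  rw [← Finset.card_filter, Fin.card_filter_val_lt]
  omega

/-- Conjugation by the reversal flips the order in both source and target, so inverted pairs stay
inverted. -/
lemma inversions_rev {n : ℕ} (σ : Equiv.Perm (Fin n)) :
    inversions (Fin.revPerm.trans (σ.trans Fin.revPerm)) = inversions σ := by
  rw [inversions_eq_sum, inversions_eq_sum, Finset.sum_comm, ← Equiv.sum_comp Fin.revPerm]
  refine Finset.sum_congr rfl fun a _ => ?_
  rw [← Equiv.sum_comp Fin.revPerm]
  simp

end Permutations

/-! ### The q-pairing: adjointness of creation and annihilation, reversal invariance. -/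

section Pairing

variable {H : Type*} [NormedAddCommGroup H] [InnerProductSpace ℝ H]

/-- A q-analogue of the Laplace expansion along the first row: permutations are sorted by the image
of the first point. -/
lemma qPairing_cons (q : ℝ) {n : ℕ} (x : Cplx H) (v : Fin n → Cplx H) (w : Fin (n + 1) → Cplx H) :
    qPairing H q (n + 1) (PiTensorProduct.tprod ℂ (Fin.cons x v)) (PiTensorProduct.tprod ℂ w) =
      ∑ i : Fin (n + 1), (q : ℂ) ^ (i : ℕ) * bil H x (w i) *
        qPairing H q n (PiTensorProduct.tprod ℂ v) (PiTensorProduct.tprod ℂ (i.removeNth w)) := by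
  rw [qPairing_tprod, ← (consPerm_bijective n).sum_comp, Fintype.sum_prod_type]
  refine Finset.sum_congr rfl fun i _ => ?_
  rw [qPairing_tprod, Finset.mul_sum]
  refine Finset.sum_congr rfl fun e _ => ?_
  rw [inversions_consPerm, Fin.prod_univ_succ]
  simp only [Fin.cons_zero, Fin.cons_succ, consPerm_zero, consPerm_succ, Fin.removeNth_apply]
  ring

lemma qPairing_rev (q : ℝ) {n : ℕ} (v w : Fin n → Cplx H) :
    qPairing H q n (PiTensorProduct.tprod ℂ (v ∘ Fin.rev)) (PiTensorProduct.tprod ℂ (w ∘ Fin.rev)) =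
      qPairing H q n (PiTensorProduct.tprod ℂ v) (PiTensorProduct.tprod ℂ w) := by
  rw [qPairing_tprod, qPairing_tprod]
  have hb : Function.Involutive fun σ : Equiv.Perm (Fin n) =>
      (Fin.revPerm.trans (σ.trans Fin.revPerm) : Equiv.Perm (Fin n)) := fun σ => by
    ext; simp
  rw [← hb.bijective.sum_comp]
  refine Finset.sum_congr rfl fun σ _ => ?_
  rw [inversions_rev, ← Equiv.prod_comp Fin.revPerm]
  simp

lemma removeNth_succ {α : Type*} {n : ℕ} (i : Fin (n + 1)) (w : Fin (n + 2) → α) :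
    i.succ.removeNth w = Fin.cons (w 0) (i.removeNth (Fin.tail w)) := by
  funext j
  refine Fin.cases ?_ (fun j => ?_) j
  · simp [Fin.removeNth_apply]
  · simp [Fin.removeNth_apply, Fin.tail]

/-- The coefficients agree with those of `qPairing_cons`; this match is what makes annihilation
adjoint to creation. -/
lemma annih_of_tprod (q : ℂ) (x : Cplx H) {n : ℕ} (w : Fin (n + 1) → Cplx H) :
    annih q x (DirectSum.of (fun n => Tens H n) (n + 1) (PiTensorProduct.tprod ℂ w)) =
      ∑ i : Fin (n + 1), (q ^ (i : ℕ) * bil H x (w i)) •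
        DirectSum.of (fun n => Tens H n) n (PiTensorProduct.tprod ℂ (i.removeNth w)) := by
  have h0 : ∀ {m : ℕ} (w : Fin (m + 1) → Cplx H), Fin.removeNth 0 w = Fin.tail w := fun w => by
    funext j; simp [Fin.removeNth_apply, Fin.tail]
  induction n with
  | zero =>
    rw [← Fin.cons_self_tail w, of_tprod_cons, annih_gen_mul, of_tprod_zero]
    simp [of_tprod_zero]
  | succ n ih =>
    conv_lhs => rw [← Fin.cons_self_tail w, of_tprod_cons, annih_gen_mul, ih]
    rw [Fin.sum_univ_succ (n := n + 1), h0, Finset.mul_sum, Finset.smul_sum]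
    congr 1
    · simp
    · refine Finset.sum_congr rfl fun i _ => ?_
      rw [removeNth_succ, of_tprod_cons, mul_smul_comm, smul_smul, Fin.val_succ, pow_succ',
        mul_assoc]
      rfl

/-- The `q`-duality pairing on the algebraic Fock space, weighted by `c n` in degree `n`. -/
def fockPairing (q : ℝ) (c : ℕ → ℂ) : AlgFock H →ₗ[ℂ] AlgFock H →ₗ[ℂ] ℂ :=
  DirectSum.toModule ℂ ℕ _ fun n =>
    c n • (qPairing H q n).compl₂ (DirectSum.component ℂ ℕ (fun n => Tens H n) n)

lemma fockPairing_of (q : ℝ) (c : ℕ → ℂ) (n : ℕ) (x : Tens H n) (η : AlgFock H) :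
    fockPairing q c (DirectSum.of (fun n => Tens H n) n x) η = c n * qPairing H q n x (η n) := by
  rw [fockPairing, ← DirectSum.lof_eq_of ℂ, DirectSum.toModule_lof]
  rfl

lemma fockPairing_one_left (q : ℝ) (c : ℕ → ℂ) (n : ℕ) (y : Tens H n) (hn : n ≠ 0) :
    fockPairing q c 1 (DirectSum.of (fun n => Tens H n) n y) = 0 := by
  rw [← of_tprod_zero (H := H) Fin.elim0, fockPairing_of, DirectSum.of_eq_of_ne _ _ _ hn.symm]
  simp

lemma fockPairing_one_one (q : ℝ) (c : ℕ → ℂ) : fockPairing q c (1 : AlgFock H) 1 = c 0 := by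
  rw [← of_tprod_zero (H := H) Fin.elim0, fockPairing_of, DirectSum.of_eq_same, qPairing_tprod]
  simp [inversions]

/-- Moving a letter across lowers the degree by one, which shifts the weight. This shift is where
the recursion of the antipode weights enters. -/
lemma fockPairing_gen_mul (q : ℝ) (c : ℕ → ℂ) (x : Cplx H) (ξ η : AlgFock H) :
    fockPairing q c (gen x * ξ) η = fockPairing q (fun n => c (n + 1)) ξ (annih q x η) := by
  suffices h : (fockPairing q c).comp (LinearMap.mulLeft ℂ (gen x)) =
      (fockPairing q fun n => c (n + 1)).compl₂ (annih q x) from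
    LinearMap.congr_fun (LinearMap.congr_fun h ξ) η
  refine LinearMap.ext fun ξ => mem_of_tprod_mem
    (p := LinearMap.eqLocus _ _) (fun n v => LinearMap.ext fun η => mem_of_tprod_mem
      (p := LinearMap.eqLocus _ _) (fun m w => ?_) η) ξ
  simp only [LinearMap.mem_eqLocus, LinearMap.comp_apply, LinearMap.mulLeft_apply,
    LinearMap.compl₂_apply]
  rw [← of_tprod_cons, fockPairing_of, fockPairing_of]
  cases m with
  | zero =>
    rw [DirectSum.of_eq_of_ne _ _ _ (Nat.succ_ne_zero n), of_tprod_zero]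
    simp
  | succ m =>
    rw [annih_of_tprod, DFinsupp.finsetSum_apply]
    by_cases h : n = m
    · subst h
      simp only [DirectSum.of_eq_same, DirectSum.smul_apply, map_sum, map_smul, smul_eq_mul]
      rw [qPairing_cons]
    · rw [DirectSum.of_eq_of_ne _ _ _ (by omega)]
      simp [DirectSum.smul_apply, DirectSum.of_eq_of_ne _ _ _ h]

lemma fockPairing_qNumber (q : ℝ) (c : ℕ → ℂ) (r : ℂ) (ξ η : AlgFock H) :
    fockPairing q c (qNumber r ξ) η = fockPairing q (fun n => r ^ n * c n) ξ η := by
  induction ξ using DirectSum.induction_on with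
  | zero => simp
  | add x y hx hy => simp only [map_add, LinearMap.add_apply, hx, hy]
  | of n x =>
    rw [qNumber_of, map_smul, LinearMap.smul_apply, fockPairing_of, fockPairing_of, smul_eq_mul,
      mul_assoc]

lemma fockPairing_neg (q : ℝ) (c : ℕ → ℂ) (ξ η : AlgFock H) :
    fockPairing q (fun n => -c n) ξ η = -fockPairing q c ξ η := by
  induction ξ using DirectSum.induction_on with
  | zero => simp
  | add x y hx hy => simp only [map_add, LinearMap.add_apply, hx, hy, neg_add]
  | of n x => rw [fockPairing_of, fockPairing_of, neg_mul]

variable (q : Set.Ioo (-1 : ℝ) 1)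

/-- `fockForm` is antilinear on the left and is not bundled as a map, so the reduction to pure
tensors is set up by hand. -/
lemma fockForm_eq_of_of_tprod {f g f' g' : AlgFock H →ₗ[ℂ] AlgFock H}
    (h : ∀ (n : ℕ) (v : Fin n → Cplx H) (η : AlgFock H),
      fockForm q H (f (DirectSum.of (fun n => Tens H n) n (PiTensorProduct.tprod ℂ v))) (g η) =
      fockForm q H (f' (DirectSum.of (fun n => Tens H n) n (PiTensorProduct.tprod ℂ v))) (g' η))
    (ξ η : AlgFock H) : fockForm q H (f ξ) (g η) = fockForm q H (f' ξ) (g' η) := by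
  have h0 : ∀ ζ : AlgFock H, fockForm q H 0 ζ = 0 := fun ζ => by
    simpa using fockForm_smul_left q 0 0 ζ
  let p : Submodule ℂ (AlgFock H) :=
    { carrier := {ξ | fockForm q H (f ξ) (g η) = fockForm q H (f' ξ) (g' η)}
      add_mem' := fun {a b} ha hb => by
        change fockForm q H _ _ = fockForm q H _ _ at ha hb ⊢
        rw [map_add, map_add, fockForm_add_left, fockForm_add_left, ha, hb]
      zero_mem' := by
        change fockForm q H _ _ = fockForm q H _ _
        rw [map_zero, map_zero, h0, h0]
      smul_mem' := fun c a ha => by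
        change fockForm q H _ _ = fockForm q H _ _ at ha ⊢
        rw [map_smul, map_smul, fockForm_smul_left, fockForm_smul_left, ha] }
  exact mem_of_tprod_mem (p := p) (fun n v => h n v η) ξ

/-- Transfers facts about the bilinear pairing to the inner product, by conjugating the left
argument. -/
lemma fockForm_of_left (n : ℕ) (x : Tens H n) (η : AlgFock H) :
    fockForm q H (DirectSum.of (fun n => Tens H n) n x) η =
      fockPairing (q : ℝ) 1 (DirectSum.of (fun n => Tens H n) n (conjTens H n x)) η := by
  rw [fockPairing_of]
  induction η using DirectSum.induction_on with
  | zero => simp [fockForm]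
  | add y y' hy hy' => rw [fockForm_add_right, hy, hy', DirectSum.add_apply, map_add, mul_add]
  | of m y =>
    rw [fockForm_of]
    by_cases h : n = m
    · subst h; simp [qForm]
    · rw [DirectSum.of_eq_of_ne _ _ _ h, DirectSum.of_eq_of_ne _ _ _ (Ne.symm h)]
      simp

/-- Left annihilation is the formal adjoint of left creation. -/
lemma fockForm_letter_mul (h : H) (ξ η : AlgFock H) :
    fockForm q H (letter h * ξ) η = fockForm q H ξ (annih ((q : ℝ) : ℂ) ((1 : ℂ) ⊗ₜ h) η) := by
  refine fockForm_eq_of_of_tprod q (f := LinearMap.mulLeft ℂ (letter h)) (g := LinearMap.id)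
    (f' := LinearMap.id) (fun n v η => ?_) ξ η
  simp only [LinearMap.mulLeft_apply, LinearMap.id_apply]
  rw [letter_eq_gen, ← of_tprod_cons, fockForm_of_left, fockForm_of_left, conjTens_tprod,
    conjTens_tprod]
  have : (fun i => conjC H ((Fin.cons ((1 : ℂ) ⊗ₜ[ℝ] h) v : Fin (n + 1) → Cplx H) i)) =
      Fin.cons ((1 : ℂ) ⊗ₜ[ℝ] h) fun i => conjC H (v i) := by
    funext i
    refine Fin.cases ?_ (fun i => ?_) i <;> simp
  rw [this, of_tprod_cons, fockPairing_gen_mul]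
  rfl

lemma fockPairing_rev (c : ℕ → ℂ) (q : ℝ) (ξ η : AlgFock H) :
    fockPairing q c (rev ξ) (rev η) = fockPairing q c ξ η := by
  suffices h : ((fockPairing q c).comp rev).compl₂ rev = fockPairing q c (H := H) from
    LinearMap.congr_fun (LinearMap.congr_fun h ξ) η
  refine LinearMap.ext fun ξ => mem_of_tprod_mem
    (p := LinearMap.eqLocus _ _) (fun n v => LinearMap.ext fun η => mem_of_tprod_mem
      (p := LinearMap.eqLocus _ _) (fun m w => ?_) η) ξ
  simp only [LinearMap.mem_eqLocus, LinearMap.comp_apply, LinearMap.compl₂_apply]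
  rw [rev_of_tprod, rev_of_tprod, fockPairing_of, fockPairing_of]
  by_cases h : n = m
  · subst h
    simp [qPairing_rev]
  · simp [DirectSum.of_eq_of_ne _ _ _ h]

/-- Reversal is isometric, so results on left creation carry over to right creation. -/
lemma fockForm_rev (ξ η : AlgFock H) : fockForm q H (rev ξ) (rev η) = fockForm q H ξ η := by
  refine fockForm_eq_of_of_tprod q (f := rev) (g := rev)
    (f' := LinearMap.id) (g' := LinearMap.id) (fun n v η => ?_) ξ η
  simp only [LinearMap.id_apply]
  rw [rev_of_tprod, fockForm_of_left, fockForm_of_left, conjTens_tprod, conjTens_tprod,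
    ← fockPairing_rev _ _ (DirectSum.of _ _ _) η, rev_of_tprod]
  rfl

end Pairing


/-! ### The maps R* as one braided comultiplication. -/

section Subsets

/-- Subsets are sorted by whether they contain 0, that is, by the leg that receives the first
letter. -/
lemma sum_finset_fin_succ {M : Type*} [AddCommMonoid M] {n : ℕ} (f : Finset (Fin (n + 1)) → M) :
    ∑ S, f S = ∑ S : Finset (Fin n), f (insert 0 (S.map (Fin.succEmb n))) +
      ∑ S : Finset (Fin n), f (S.map (Fin.succEmb n)) := by
  have h0 : (0 : Fin (n + 1)) ∉ Finset.univ.image Fin.succ := by simp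
  have hinj : Function.Injective (Finset.image (Fin.succ (n := n))) :=
    Finset.image_injective (Fin.succ_injective n)
  have hu : (Finset.univ : Finset (Fin (n + 1))) = insert 0 (Finset.univ.image Fin.succ) := by
    ext i
    refine Fin.cases ?_ (fun i => ?_) i <;> simp
  rw [← Finset.powerset_univ, hu, Finset.sum_powerset_insert h0, Finset.powerset_image,
    Finset.sum_image hinj.injOn, Finset.sum_image hinj.injOn, Finset.powerset_univ, add_comm]
  simp only [Finset.map_eq_image]
  rfl

lemma shuffleInversions_eq_sum {n : ℕ} (S : Finset (Fin n)) :
    shuffleInversions S = ∑ a, ∑ b, if a ∈ S ∧ b ∉ S ∧ b < a then 1 else 0 := by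
  rw [shuffleInversions, ← Finset.sum_product', Finset.univ_product_univ, ← Finset.card_filter]
  congr 1
  ext p
  simp [and_assoc]

lemma succ_mem_map_succ {n : ℕ} {S : Finset (Fin n)} {j : Fin n} :
    j.succ ∈ S.map (Fin.succEmb n) ↔ j ∈ S := by simp

lemma zero_notMem_map_succ {n : ℕ} (S : Finset (Fin n)) : 0 ∉ S.map (Fin.succEmb n) := by
  simp [Fin.succ_ne_zero]

lemma shuffleInversions_insert_zero_map {n : ℕ} (S : Finset (Fin n)) :
    shuffleInversions (insert 0 (S.map (Fin.succEmb n))) = shuffleInversions S := by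
  simp only [shuffleInversions_eq_sum, Fin.sum_univ_succ, Finset.mem_insert, succ_mem_map_succ,
    Fin.succ_ne_zero, false_or, true_or, not_true, false_and, and_false, if_false,
    Fin.succ_lt_succ_iff, Fin.not_lt_zero, Finset.sum_const_zero, zero_add]

/-- Here 0 lies in the complement and precedes every element of the set, so it adds one inversion
per element. -/
lemma shuffleInversions_map_succ {n : ℕ} (S : Finset (Fin n)) :
    shuffleInversions (S.map (Fin.succEmb n)) = S.card + shuffleInversions S := by
  simp only [shuffleInversions_eq_sum, Fin.sum_univ_succ, succ_mem_map_succ, zero_notMem_map_succ,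
    false_and, not_false_eq_true, Fin.succ_pos, true_and, and_true, if_false,
    Fin.succ_lt_succ_iff, Finset.sum_const_zero, zero_add, Finset.sum_add_distrib]
  simp

lemma compl_map_succ {n : ℕ} (S : Finset (Fin n)) :
    (S.map (Fin.succEmb n))ᶜ = insert 0 (Sᶜ.map (Fin.succEmb n)) := by
  ext i
  refine Fin.cases ?_ (fun i => ?_) i <;> simp [Fin.succ_ne_zero]

lemma compl_insert_zero_map {n : ℕ} (S : Finset (Fin n)) :
    (insert 0 (S.map (Fin.succEmb n)))ᶜ = Sᶜ.map (Fin.succEmb n) := by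
  rw [← compl_inj_iff, compl_compl, compl_map_succ, compl_compl]

variable {H : Type*} [NormedAddCommGroup H] [InnerProductSpace ℝ H]

/-- The product of the letters of `v` with index in `S`, in increasing order. -/
def subword {n : ℕ} (S : Finset (Fin n)) (v : Fin n → Cplx H) : AlgFock H :=
  (S.sort.map fun i => gen (v i)).prod

lemma subword_map_succ {n : ℕ} (S : Finset (Fin n)) (x : Cplx H) (v : Fin n → Cplx H) :
    subword (S.map (Fin.succEmb n)) (Fin.cons x v) = subword S v := by
  have h := StrictMonoOn.map_finsetSort (f := Fin.succEmb n) (s := S)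
    ((Fin.strictMono_succ (n := n)).strictMonoOn _)
  rw [subword, ← h, List.map_map]
  rfl

lemma subword_insert_zero_map {n : ℕ} (S : Finset (Fin n)) (x : Cplx H) (v : Fin n → Cplx H) :
    subword (insert 0 (S.map (Fin.succEmb n))) (Fin.cons x v) = gen x * subword S v := by
  rw [subword, Finset.sort_insert _ (fun b _ => Fin.zero_le b) (by simp [Fin.succ_ne_zero]),
    List.map_cons, List.prod_cons, Fin.cons_zero]
  congr 1
  exact subword_map_succ S x v

lemma qNumber_subword (q : ℂ) {n : ℕ} (S : Finset (Fin n)) (v : Fin n → Cplx H) :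
    qNumber q (subword S v) = q ^ S.card • subword S v := by
  have : ∀ l : List (Fin n), qNumber q (l.map fun i => gen (v i)).prod =
      q ^ l.length • (l.map fun i => gen (v i)).prod := by
    intro l
    induction l with
    | nil => simp
    | cons i l ih =>
      rw [List.map_cons, List.prod_cons, map_mul, ih, qNumber_gen, smul_mul_smul_comm,
        List.length_cons, pow_succ']
  rw [subword, this, Finset.length_sort]

/-- The inclusion of `H_ℂ^{⊗ a} ⊗ H_ℂ^{⊗ b}` in the tensor square of the algebraic Fock space. -/
def lofTensor (a b : ℕ) : Tens H a ⊗[ℂ] Tens H b →ₗ[ℂ] AlgFock H ⊗[ℂ] AlgFock H :=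
  TensorProduct.map (DirectSum.lof ℂ ℕ (fun n => Tens H n) a)
    (DirectSum.lof ℂ ℕ (fun n => Tens H n) b)

lemma lofTensor_split {n a b : ℕ} (S : Finset (Fin n)) (hS : S.card = a) (hS' : Sᶜ.card = b)
    (v : Fin n → Cplx H) :
    lofTensor a b (split H S hS hS' (PiTensorProduct.tprod ℂ v)) =
      subword S v ⊗ₜ subword Sᶜ v := by
  rw [split, LinearMap.comp_apply, LinearEquiv.coe_coe, LinearEquiv.coe_coe,
    PiTensorProduct.reindex_tprod, PiTensorProduct.tmulEquiv_symm_apply, lofTensor,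
    TensorProduct.map_tmul, DirectSum.lof_eq_of, DirectSum.lof_eq_of, of_tprod, of_tprod, subword,
    subword, ← S.listMap_orderEmbOfFin_finRange hS, ← Sᶜ.listMap_orderEmbOfFin_finRange hS',
    List.map_map, List.map_map, List.ofFn_eq_map, List.ofFn_eq_map]
  rfl

/-- The sum of all the maps `R*`, the comultiplication of the braided Hopf algebra `𝓕(H)`. -/
def coprod (q : ℝ) : AlgFock H →ₗ[ℂ] AlgFock H ⊗[ℂ] AlgFock H :=
  DirectSum.toModule ℂ ℕ _ fun n => ∑ S : Finset (Fin n),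
    ((q : ℂ) ^ shuffleInversions S) • lofTensor S.card Sᶜ.card ∘ₗ split H S rfl rfl

lemma coprod_of (q : ℝ) (n : ℕ) (x : Tens H n) :
    coprod q (DirectSum.of (fun n => Tens H n) n x) = ∑ S : Finset (Fin n),
      ((q : ℂ) ^ shuffleInversions S) • lofTensor S.card Sᶜ.card (split H S rfl rfl x) := by
  rw [coprod, ← DirectSum.lof_eq_of ℂ, DirectSum.toModule_lof, LinearMap.sum_apply]
  rfl

lemma lofTensor_rStar (q : ℝ) (n a b : ℕ) (x : Tens H n) :
    lofTensor a b (rStar q H n a b x) = ∑ S : Finset (Fin n),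
      if S.card = a ∧ Sᶜ.card = b then
        ((q : ℂ) ^ shuffleInversions S) • lofTensor S.card Sᶜ.card (split H S rfl rfl x) else 0 := by
  rw [← Finset.sum_filter, Finset.sum_subtype (p := fun S => S.card = a ∧ Sᶜ.card = b) _ (by simp),
    rStar, LinearMap.sum_apply, map_sum]
  refine Finset.sum_congr rfl fun S _ => ?_
  obtain ⟨S, rfl, rfl⟩ := S
  rw [LinearMap.smul_apply, map_smul]

/-- Each subset contributes to exactly one `j`, the size of its complement, and terms with `j > n`
vanish. The free bound `M` lets this expansion and its left counterpart run over a common range in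
spite of different degrees. -/
lemma coprod_of_eq_sum_right (q : ℝ) {n M : ℕ} (hM : n < M) (x : Tens H n) :
    coprod q (DirectSum.of (fun n => Tens H n) n x) =
      ∑ j ∈ Finset.range M, lofTensor (n - j) j (rStar q H n (n - j) j x) := by
  simp only [lofTensor_rStar]
  rw [Finset.sum_comm, coprod_of]
  refine Finset.sum_congr rfl fun S _ => ?_
  have hc := S.card_add_card_compl
  rw [Fintype.card_fin] at hc
  rw [Finset.sum_eq_single Sᶜ.card]
  · rw [if_pos (by omega)]
  · intro j _ hj; rw [if_neg (by omega)]
  · intro h; exact absurd (Finset.mem_range.2 (by omega)) h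

lemma coprod_of_eq_sum_left (q : ℝ) {n M : ℕ} (hM : n < M) (x : Tens H n) :
    coprod q (DirectSum.of (fun n => Tens H n) n x) =
      ∑ j ∈ Finset.range M, lofTensor j (n - j) (rStar q H n j (n - j) x) := by
  simp only [lofTensor_rStar]
  rw [Finset.sum_comm, coprod_of]
  refine Finset.sum_congr rfl fun S _ => ?_
  have hc := S.card_add_card_compl
  rw [Fintype.card_fin] at hc
  rw [Finset.sum_eq_single S.card]
  · rw [if_pos (by omega)]
  · intro j _ hj; rw [if_neg (by omega)]
  · intro h; exact absurd (Finset.mem_range.2 (by omega)) h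

/-- Multiplication by `Δ x = x ⊗ 1 + 1 ⊗ x` in the braided tensor square. -/
def braidedMul (q : ℝ) (x : Cplx H) : AlgFock H ⊗[ℂ] AlgFock H →ₗ[ℂ] AlgFock H ⊗[ℂ] AlgFock H :=
  LinearMap.rTensor (AlgFock H) (LinearMap.mulLeft ℂ (gen x)) +
    TensorProduct.map (qNumber (q : ℂ)).toLinearMap (LinearMap.mulLeft ℂ (gen x))

lemma braidedMul_tmul (q : ℝ) (x : Cplx H) (a b : AlgFock H) :
    braidedMul q x (a ⊗ₜ b) = (gen x * a) ⊗ₜ b + qNumber (q : ℂ) a ⊗ₜ (gen x * b) := by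
  simp [braidedMul]

lemma coprod_one (q : ℝ) : coprod q (1 : AlgFock H) = 1 ⊗ₜ 1 := by
  rw [← of_tprod_zero (H := H) Fin.elim0, coprod_of]
  simp only [lofTensor_split]
  rw [Finset.sum_eq_single ∅ (fun S _ hS => absurd (Finset.eq_empty_of_isEmpty S) hS)
    (fun h => absurd (Finset.mem_univ _) h),
    Finset.eq_empty_of_isEmpty ∅ᶜ]
  simp [subword, shuffleInversions, of_tprod_zero]

/-- The first letter goes left at no cost, or goes right past the |S| letters of the left leg; the
resulting factor q^|S| is `qNumber` on that leg. -/
lemma coprod_gen_mul (q : ℝ) (x : Cplx H) (ξ : AlgFock H) :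
    coprod q (gen x * ξ) = braidedMul q x (coprod q ξ) := by
  suffices h : coprod q ∘ₗ LinearMap.mulLeft ℂ (gen x) = braidedMul q x ∘ₗ coprod q from
    LinearMap.congr_fun h ξ
  refine LinearMap.ext fun ξ => mem_of_tprod_mem (p := LinearMap.eqLocus _ _) (fun n v => ?_) ξ
  simp only [LinearMap.mem_eqLocus, LinearMap.comp_apply, LinearMap.mulLeft_apply]
  rw [← of_tprod_cons, coprod_of, coprod_of, sum_finset_fin_succ, map_sum,
    ← Finset.sum_add_distrib]
  refine Finset.sum_congr rfl fun S _ => ?_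
  rw [lofTensor_split, lofTensor_split, lofTensor_split, shuffleInversions_insert_zero_map,
    shuffleInversions_map_succ, compl_map_succ, compl_insert_zero_map, subword_insert_zero_map,
    subword_map_succ, subword_map_succ, subword_insert_zero_map, map_smul, braidedMul_tmul,
    qNumber_subword, smul_add, ← TensorProduct.smul_tmul' (_ ^ S.card), smul_smul, add_comm S.card,
    pow_add]

end Subsets

/-! ### Compatibility of the comultiplication with degree, annihilation and counit. -/

section Comultiplication

variable {H : Type*} [NormedAddCommGroup H] [InnerProductSpace ℝ H]

lemma qNumber_qNumber (q r : ℂ) (ξ : AlgFock H) :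
    qNumber q (qNumber r ξ) = qNumber (q * r) ξ := by
  suffices h : (qNumber q).toLinearMap ∘ₗ (qNumber r).toLinearMap =
      (qNumber (q * r) : AlgFock H →ₐ[ℂ] _).toLinearMap from LinearMap.congr_fun h ξ
  refine linearMap_ext_gen_mul (by simp) fun x ξ h => ?_
  simp only [LinearMap.comp_apply, AlgHom.toLinearMap_apply] at h ⊢
  rw [map_mul, map_mul, map_mul, h, qNumber_gen, map_smul, qNumber_gen, qNumber_gen, smul_smul,
    mul_comm q]

lemma annih_qNumber (q r : ℂ) (x : Cplx H) (ξ : AlgFock H) :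
    annih q x (qNumber r ξ) = r • qNumber r (annih q x ξ) := by
  suffices h : annih q x ∘ₗ (qNumber r).toLinearMap = r • (qNumber r).toLinearMap ∘ₗ annih q x from
    LinearMap.congr_fun h ξ
  refine linearMap_ext_gen_mul (by simp) fun y ξ h => ?_
  simp only [LinearMap.comp_apply, AlgHom.toLinearMap_apply, LinearMap.smul_apply] at h ⊢
  rw [map_mul, qNumber_gen, smul_mul_assoc, map_smul, annih_gen_mul, annih_gen_mul, h]
  simp only [map_add, map_smul, map_mul, qNumber_gen, smul_add, smul_smul, mul_smul_comm,
    smul_mul_assoc]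

lemma coprod_qNumber (q : ℝ) (r : ℂ) (ξ : AlgFock H) :
    coprod q (qNumber r ξ) =
      TensorProduct.map (qNumber r).toLinearMap (qNumber r).toLinearMap (coprod q ξ) := by
  suffices h : coprod q ∘ₗ (qNumber r).toLinearMap =
      TensorProduct.map (qNumber r).toLinearMap (qNumber r).toLinearMap ∘ₗ coprod q (H := H) from
    LinearMap.congr_fun h ξ
  refine linearMap_ext_gen_mul (by simp [coprod_one]) fun y ξ h => ?_
  simp only [LinearMap.comp_apply, AlgHom.toLinearMap_apply] at h ⊢
  rw [map_mul, qNumber_gen, smul_mul_assoc, map_smul, coprod_gen_mul, h, coprod_gen_mul]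
  generalize coprod q ξ = t
  induction t using TensorProduct.induction_on with
  | zero => simp
  | add t u ht hu => simp only [map_add, smul_add, ht, hu]
  | tmul a b =>
    simp only [TensorProduct.map_tmul, braidedMul_tmul, AlgHom.toLinearMap_apply, map_add, map_mul,
      qNumber_gen, qNumber_qNumber, smul_add, smul_mul_assoc, TensorProduct.smul_tmul',
      TensorProduct.tmul_smul, mul_comm r]

/-- Coassociativity against a vector of degree one. -/
lemma coprod_annih (q : ℝ) (x : Cplx H) (ξ : AlgFock H) :
    coprod q (annih q x ξ) = LinearMap.rTensor (AlgFock H) (annih q x) (coprod q ξ) := by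
  suffices h : coprod q ∘ₗ annih q x = LinearMap.rTensor (AlgFock H) (annih q x) ∘ₗ coprod q from
    LinearMap.congr_fun h ξ
  refine linearMap_ext_gen_mul (by simp [coprod_one]) fun y ξ h => ?_
  simp only [LinearMap.comp_apply] at h ⊢
  rw [annih_gen_mul, map_add, map_smul, map_smul, coprod_gen_mul, h, coprod_gen_mul]
  generalize coprod q ξ = t
  induction t using TensorProduct.induction_on with
  | zero => simp
  | add t u ht hu => simp only [map_add, smul_add, ← ht, ← hu]; abel
  | tmul a b =>
    simp only [LinearMap.rTensor_tmul, braidedMul_tmul, annih_gen_mul, annih_qNumber, map_add,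
      TensorProduct.add_tmul, smul_add, TensorProduct.smul_tmul', add_assoc]

lemma fockPairing_one_gen_mul (q : ℝ) (c : ℕ → ℂ) (x : Cplx H) (η : AlgFock H) :
    fockPairing q c 1 (gen x * η) = 0 := by
  suffices h : fockPairing q c 1 ∘ₗ LinearMap.mulLeft ℂ (gen x) = 0 from LinearMap.congr_fun h η
  refine LinearMap.ext fun ξ => mem_of_tprod_mem (p := LinearMap.eqLocus _ _) (fun n v => ?_) ξ
  simp only [LinearMap.mem_eqLocus, LinearMap.comp_apply, LinearMap.mulLeft_apply]
  rw [← of_tprod_cons, fockPairing_one_left _ _ _ _ n.succ_ne_zero]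
  rfl

lemma fockPairing_one_qNumber (q : ℝ) (c : ℕ → ℂ) (r : ℂ) (η : AlgFock H) :
    fockPairing q c 1 (qNumber r η) = fockPairing q c 1 η := by
  suffices h : fockPairing q c 1 ∘ₗ (qNumber r).toLinearMap = fockPairing q c 1 (H := H) from
    LinearMap.congr_fun h η
  refine linearMap_ext_gen_mul (by simp) fun x ξ _ => ?_
  simp [fockPairing_one_gen_mul]

/-- The functional `fockPairing q c 1` is a counit. -/
lemma counit_coprod (q : ℝ) (c : ℕ → ℂ) (hc : c 0 = 1) (η : AlgFock H) :
    TensorProduct.lid ℂ (AlgFock H)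
      (LinearMap.rTensor (AlgFock H) (fockPairing q c 1) (coprod q η)) = η := by
  suffices h : (TensorProduct.lid ℂ (AlgFock H)).toLinearMap ∘ₗ
      LinearMap.rTensor (AlgFock H) (fockPairing q c 1) ∘ₗ coprod q = LinearMap.id from
    LinearMap.congr_fun h η
  refine linearMap_ext_gen_mul (by simp [coprod_one, fockPairing_one_one, hc]) fun x ξ h => ?_
  simp only [LinearMap.comp_apply, LinearMap.id_apply, LinearEquiv.coe_coe] at h ⊢
  rw [coprod_gen_mul]
  conv_rhs => rw [← h]
  generalize coprod q ξ = t
  induction t using TensorProduct.induction_on with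
  | zero => simp
  | add t u ht hu => simp only [map_add, mul_add, ht, hu]
  | tmul a b =>
    simp [braidedMul_tmul, fockPairing_one_gen_mul, fockPairing_one_qNumber]

end Comultiplication

/-! ### The Wick formula for any linear map satisfying the creation recursion. -/

section WickFormula

variable {H : Type*} [NormedAddCommGroup H] [InnerProductSpace ℝ H]
variable {B : Type*} [Ring B] [Algebra ℂ B] (W : AlgFock H →ₗ[ℂ] B)

/-- The bilinear map `(x₁ ⊗ x₂, y₁ ⊗ y₂) ↦ ⟨x₂, y₁⟩ W(x₁) W(y₂)`, the pairing being
`fockPairing q c`. -/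
def contraction (q : ℝ) (c : ℕ → ℂ) :
    (AlgFock H ⊗[ℂ] AlgFock H) ⊗[ℂ] (AlgFock H ⊗[ℂ] AlgFock H) →ₗ[ℂ] B :=
  LinearMap.mul' ℂ B ∘ₗ TensorProduct.map W W ∘ₗ
    LinearMap.lTensor (AlgFock H)
      ((TensorProduct.lid ℂ (AlgFock H)).toLinearMap ∘ₗ
        LinearMap.rTensor (AlgFock H) (TensorProduct.lift (fockPairing q c)) ∘ₗ
        (TensorProduct.assoc ℂ (AlgFock H) (AlgFock H) (AlgFock H)).symm.toLinearMap) ∘ₗ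
    (TensorProduct.assoc ℂ (AlgFock H) (AlgFock H) (AlgFock H ⊗[ℂ] AlgFock H)).toLinearMap

lemma contraction_tmul (q : ℝ) (c : ℕ → ℂ) (a b a' b' : AlgFock H) :
    contraction W q c ((a ⊗ₜ b) ⊗ₜ (a' ⊗ₜ b')) = fockPairing q c b a' • (W a * W b') := by
  simp [contraction]

lemma tensor_square_induction {M N : Type*} [AddCommMonoid M] [AddCommMonoid N] [Module ℂ M]
    [Module ℂ N] {p : M ⊗[ℂ] M → N ⊗[ℂ] N → Prop} (t : M ⊗[ℂ] M) (u : N ⊗[ℂ] N)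
    (h0 : ∀ u, p 0 u) (h0' : ∀ t, p t 0) (ht : ∀ t t' u, p t u → p t' u → p (t + t') u)
    (hu : ∀ t u u', p t u → p t u' → p t (u + u'))
    (h : ∀ a b a' b', p (a ⊗ₜ b) (a' ⊗ₜ b')) : p t u := by
  induction t using TensorProduct.induction_on with
  | zero => exact h0 u
  | add t t' h1 h2 => exact ht _ _ _ h1 h2
  | tmul a b =>
    induction u using TensorProduct.induction_on with
    | zero => exact h0' _
    | add u u' h1 h2 => exact hu _ _ _ h1 h2
    | tmul a' b' => exact h a b a' b'

/-- The weights `(-1)^j q^(j choose 2)` of the antipode. -/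
def antipodeWeight (q : ℝ) (j : ℕ) : ℂ := (-1) ^ j * (q : ℂ) ^ j.choose 2

/-- Only this recursion and the value 1 at 0 are used in the contraction identity. -/
lemma antipodeWeight_succ (q : ℝ) (j : ℕ) :
    antipodeWeight q (j + 1) = -((q : ℂ) ^ j * antipodeWeight q j) := by
  rw [antipodeWeight, antipodeWeight, Nat.choose_succ_succ' j 1, Nat.choose_one_right, pow_add,
    pow_succ]
  ring

/-- If `x` joins the outer leg, `hs` gives the first two terms. If it joins the inner leg, it
becomes annihilation on `u`; the shifted weight −q^n c_n puts q^N on the inner leg of `t`, and the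
braiding has already put q^N on the outer one. -/
lemma contraction_braidedMul (q : ℝ) (x : Cplx H) (s : B)
    (hs : ∀ ξ, W (gen x * ξ) = s * W ξ - W (annih q x ξ))
    (t u : AlgFock H ⊗[ℂ] AlgFock H) :
    contraction W q (antipodeWeight q) (braidedMul q x t ⊗ₜ u) =
      s * contraction W q (antipodeWeight q) (t ⊗ₜ u) -
      contraction W q (antipodeWeight q) (LinearMap.rTensor _ (annih q x) t ⊗ₜ u) -
      contraction W q (antipodeWeight q)
        (TensorProduct.map (qNumber (q : ℂ)).toLinearMap (qNumber (q : ℂ)).toLinearMap t ⊗ₜ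
          LinearMap.rTensor _ (annih q x) u) := by
  induction t, u using tensor_square_induction with
  | h0 u => simp
  | h0' t => simp
  | ht t t' u h1 h2 =>
    simp only [map_add, TensorProduct.add_tmul, h1, h2, mul_add]; abel
  | hu t u u' h1 h2 =>
    simp only [map_add, TensorProduct.tmul_add, h1, h2, mul_add]; abel
  | h a b a' b' =>
    have hw : (fun n => antipodeWeight q (n + 1)) = fun n => -((q : ℂ) ^ n * antipodeWeight q n) :=
      funext (antipodeWeight_succ q)
    simp only [braidedMul_tmul, TensorProduct.add_tmul, map_add, contraction_tmul,
      LinearMap.rTensor_tmul, TensorProduct.map_tmul, AlgHom.toLinearMap_apply, hs,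
      fockPairing_gen_mul, fockPairing_qNumber, hw, fockPairing_neg, sub_mul, smul_sub, neg_smul,
      mul_assoc, mul_smul_comm]
    abel

/-- The Wick formula `∑ ⟨x₂, y₁⟩ W(x₁) W(y₂) = W(x y)` in the weighted pairing. -/
lemma contraction_coprod (q : ℝ) (s : H → B) (h1 : W 1 = 1)
    (hs : ∀ h ξ, W (letter h * ξ) = s h * W ξ - W (annih q ((1 : ℂ) ⊗ₜ h) ξ))
    (ξ η : AlgFock H) :
    contraction W q (antipodeWeight q) (coprod q ξ ⊗ₜ coprod q η) = W (ξ * η) := by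
  let p : Submodule ℂ (AlgFock H) :=
    -- The last term of `contraction_braidedMul` involves q^N ξ rather than ξ, so the claim is
    -- proved for all r^N ξ at once; r = 1 is taken at the end.
    { carrier := {ξ | ∀ (r : ℂ) (η : AlgFock H),
        contraction W q (antipodeWeight q) (coprod q (qNumber r ξ) ⊗ₜ coprod q η) =
          W (qNumber r ξ * η)}
      add_mem' := fun {a b} ha hb r η => by
        rw [map_add, map_add, TensorProduct.add_tmul, map_add, ha, hb, add_mul, map_add]
      zero_mem' := fun r η => by simp
      smul_mem' := fun c a ha r η => by
        rw [map_smul, map_smul, ← TensorProduct.smul_tmul', map_smul, ha, smul_mul_assoc,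
          map_smul] }
  have hp : ξ ∈ p := by
    refine mem_of_letter_mul_mem (q : ℂ) (fun r η => ?_) (fun h ξ hξ hd r η => ?_) ξ
    · rw [map_one, coprod_one, one_mul]
      conv_rhs => rw [← counit_coprod q (antipodeWeight q) (by simp [antipodeWeight]) η]
      generalize coprod q η = u
      induction u using TensorProduct.induction_on with
      | zero => simp
      | add u u' hu hu' => simp only [TensorProduct.tmul_add, map_add, hu, hu']
      | tmul a b => simp [contraction_tmul, h1]
    · have hd' : ∀ η, contraction W q (antipodeWeight q)
          (coprod q (annih q ((1 : ℂ) ⊗ₜ h) (qNumber r ξ)) ⊗ₜ coprod q η) =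
          W (annih q ((1 : ℂ) ⊗ₜ h) (qNumber r ξ) * η) := fun η => by
        rw [annih_qNumber, map_smul, ← TensorProduct.smul_tmul', map_smul, hd r η, smul_mul_assoc,
          map_smul]
      have hq : contraction W q (antipodeWeight q) (coprod q (qNumber (q : ℂ) (qNumber r ξ)) ⊗ₜ
          coprod q (annih q ((1 : ℂ) ⊗ₜ h) η)) =
          W (qNumber (q : ℂ) (qNumber r ξ) * annih q ((1 : ℂ) ⊗ₜ h) η) := by
        rw [qNumber_qNumber]; exact hξ _ _
      have hξ' := hξ r η
      rw [letter_eq_gen, map_mul, qNumber_gen, smul_mul_assoc, map_smul, smul_mul_assoc, map_smul,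
        ← TensorProduct.smul_tmul', map_smul]
      congr 1
      generalize qNumber r ξ = ζ at *
      simp only [letter_eq_gen] at hs
      -- The three terms become s W(ζη), W((∂ζ)η) and W((q^N ζ)(∂η)); the Leibniz rule and `hs` at
      -- ζη identify the total with W(hζη).
      rw [coprod_gen_mul, contraction_braidedMul W q _ (s h) (hs h), hξ', ← coprod_annih,
        ← coprod_annih, ← coprod_qNumber, hd', hq, mul_assoc, hs, annih_mul, map_add]
      abel
  simpa [show ∀ ξ : AlgFock H, qNumber 1 ξ = ξ from fun ξ => by
    suffices h : (qNumber 1).toLinearMap = (LinearMap.id : AlgFock H →ₗ[ℂ] AlgFock H) from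
      LinearMap.congr_fun h ξ
    exact linearMap_ext_gen_mul (by simp) fun x ξ h => by simpa using congrArg (gen x * ·) h]
    using hp 1 η

lemma contraction_lofTensor (q : ℝ) (c : ℕ → ℂ) {a i j b : ℕ} (t : Tens H a ⊗[ℂ] Tens H i)
    (u : Tens H j ⊗[ℂ] Tens H b) (hij : i ≠ j) :
    contraction W q c (lofTensor a i t ⊗ₜ lofTensor j b u) = 0 := by
  induction t using TensorProduct.induction_on with
  | zero => simp
  | add t t' h1 h2 => simp only [map_add, TensorProduct.add_tmul, h1, h2, add_zero]
  | tmul x y =>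
    induction u using TensorProduct.induction_on with
    | zero => simp
    | add u u' h1 h2 => simp only [map_add, TensorProduct.tmul_add, h1, h2, add_zero]
    | tmul x' y' =>
      rw [lofTensor, lofTensor, TensorProduct.map_tmul, TensorProduct.map_tmul, contraction_tmul,
        DirectSum.lof_eq_of ℂ ℕ _ i, fockPairing_of, DirectSum.lof_eq_of ℂ ℕ _ j,
        DirectSum.of_eq_of_ne _ _ _ hij]
      simp

lemma contraction_lofTensor_same (q : ℝ) (c : ℕ → ℂ) {a j b : ℕ} (t : Tens H a ⊗[ℂ] Tens H j)
    (u : Tens H j ⊗[ℂ] Tens H b) :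
    contraction W q c (lofTensor a j t ⊗ₜ lofTensor j b u) =
      c j • vMap W a b (contractMid q H a j b (t ⊗ₜ u)) := by
  induction t using TensorProduct.induction_on with
  | zero => simp
  | add t t' h1 h2 => simp only [map_add, TensorProduct.add_tmul, h1, h2, smul_add]
  | tmul x y =>
    induction u using TensorProduct.induction_on with
    | zero => simp
    | add u u' h1 h2 => simp only [map_add, TensorProduct.tmul_add, h1, h2, smul_add]
    | tmul x' y' =>
      rw [lofTensor, lofTensor, TensorProduct.map_tmul, TensorProduct.map_tmul, contraction_tmul,
        DirectSum.lof_eq_of ℂ ℕ _ j, fockPairing_of, DirectSum.lof_eq_of ℂ ℕ _ j,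
        DirectSum.of_eq_same]
      simp [contractMid, vMap, mul_smul]

/-- This is `contraction_coprod` in homogeneous degrees: after both comultiplications are expanded,
inner legs of different degrees are orthogonal, and the diagonal terms are the weighted `wMap`. -/
lemma betaMap_eq_sum_wMap (q : ℝ) (s : H → B) (h1 : W 1 = 1)
    (hs : ∀ h ξ, W (letter h * ξ) = s h * W ξ - W (annih q ((1 : ℂ) ⊗ₜ h) ξ)) (n k : ℕ) :
    betaMap W n k = ∑ j ∈ Finset.range (max k (n - k) + 1),
      ((-1 : ℂ) ^ j * (q : ℂ) ^ (j.choose 2)) • wMap q W n k j := by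
  refine TensorProduct.ext' fun x y => ?_
  have hβ : betaMap W n k (x ⊗ₜ y) = W (DirectSum.of (fun n => Tens H n) (n - k) x *
      DirectSum.of (fun n => Tens H n) k y) := rfl
  rw [hβ, ← contraction_coprod W q s h1 hs,
    coprod_of_eq_sum_right q (Nat.lt_succ_of_le (le_max_right k (n - k))),
    coprod_of_eq_sum_left q (Nat.lt_succ_of_le (le_max_left k (n - k))), TensorProduct.sum_tmul,
    map_sum, LinearMap.sum_apply]
  refine Finset.sum_congr rfl fun j hj => ?_
  rw [TensorProduct.tmul_sum, map_sum, Finset.sum_eq_single j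
    (fun i _ hi => contraction_lofTensor W q _ _ _ hi.symm) (fun h => absurd hj h),
    contraction_lofTensor_same]
  rfl

end WickFormula


/-! ### Bounded creation operators, and commutation of left and right. -/

section Operators

variable (q : Set.Ioo (-1 : ℝ) 1) {H : Type*} [NormedAddCommGroup H] [InnerProductSpace ℝ H]

/-- The canonical map `𝓕(H) → 𝓕_q(H)` as a linear map. -/
def vecLin : AlgFock H →ₗ[ℂ] Fock q H where
  toFun := vec q
  map_add' ξ η := UniformSpace.Completion.coe_add (α := QFock q H) ξ η
  map_smul' c ξ := UniformSpace.Completion.coe_smul (X := QFock q H) c ξ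

lemma vec_add (ξ η : AlgFock H) : vec q (ξ + η) = vec q ξ + vec q η := (vecLin q).map_add ξ η

lemma vec_smul (c : ℂ) (ξ : AlgFock H) : vec q (c • ξ) = c • vec q ξ := (vecLin q).map_smul c ξ

lemma denseRange_vec : DenseRange (vec q : AlgFock H → Fock q H) :=
  UniformSpace.Completion.denseRange_coe (α := QFock q H)

lemma inner_vec (ξ η : AlgFock H) : inner ℂ (vec q ξ) (vec q η) = fockForm q H ξ η :=
  UniformSpace.Completion.inner_coe (E := QFock q H) ξ η

lemma ext_vec {A B : Fock q H →L[ℂ] Fock q H} (h : ∀ ξ, A (vec q ξ) = B (vec q ξ)) : A = B :=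
  ContinuousLinearMap.coeFn_injective
    ((denseRange_vec q).equalizer A.continuous B.continuous (funext h))

lemma eq_of_inner_vec {x y : Fock q H}
    (h : ∀ ξ : AlgFock H, inner ℂ (vec q ξ) x = inner ℂ (vec q ξ) y) : x = y :=
  (denseRange_vec q).eq_of_inner_right ℂ h

/-- Annihilation by `h ∈ H`, with the parameter of the Fock space. -/
def annihLetter (h : H) : AlgFock H →ₗ[ℂ] AlgFock H := annih ((q : ℝ) : ℂ) ((1 : ℂ) ⊗ₜ h)

lemma annihLetter_letter_mul (h k : H) (ξ : AlgFock H) :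
    annihLetter q h (letter k * ξ) =
      ((inner ℝ h k : ℝ) : ℂ) • ξ + ((q : ℝ) : ℂ) • (letter k * annihLetter q h ξ) := by
  rw [annihLetter, letter_eq_gen, annih_gen_mul, bil_tmul]
  simp

lemma inner_vec_letter_mul (h : H) (ξ η : AlgFock H) :
    inner ℂ (vec q (letter h * ξ)) (vec q η) = inner ℂ (vec q ξ) (vec q (annihLetter q h η)) := by
  rw [inner_vec, inner_vec, fockForm_letter_mul]
  rfl

/-- Follows from ∂_h(hξ) = ‖h‖² ξ + q h ∂_h ξ and the adjointness of h and ∂_h. -/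
lemma norm_sq_vec_letter_mul (h : H) (ξ : AlgFock H) :
    ‖vec q (letter h * ξ)‖ ^ 2 =
      ‖h‖ ^ 2 * ‖vec q ξ‖ ^ 2 + q * ‖vec q (annihLetter q h ξ)‖ ^ 2 := by
  have h1 : inner ℂ (vec q (letter h * ξ)) (vec q (letter h * ξ)) =
      ((‖h‖ ^ 2 : ℝ) : ℂ) * inner ℂ (vec q ξ) (vec q ξ) +
        ((q : ℝ) : ℂ) * inner ℂ (vec q (annihLetter q h ξ)) (vec q (annihLetter q h ξ)) := by
    rw [inner_vec_letter_mul, annihLetter_letter_mul, vec_add, vec_smul, vec_smul, inner_add_right,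
      inner_smul_right, inner_smul_right, real_inner_self_eq_norm_sq]
    congr 2
    rw [← inner_conj_symm, inner_vec_letter_mul, inner_conj_symm]
  simp only [inner_self_eq_norm_sq_to_K] at h1
  refine Complex.ofReal_injective ?_
  push_cast at h1 ⊢
  exact h1

lemma norm_sq_vec_letter_mul_le (h : H) (ξ : AlgFock H) :
    ‖vec q (letter h * ξ)‖ ^ 2 ≤ ‖h‖ ^ 2 / (1 - |(q : ℝ)|) * ‖vec q ξ‖ ^ 2 := by
  have hq : 0 < 1 - |(q : ℝ)| := sub_pos.2 (abs_lt.2 q.2)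
  -- `c` is the fixed point of c = ‖h‖² + |q| c, so the bound reproduces itself in the induction on
  -- the nilpotency order.
  set c := ‖h‖ ^ 2 / (1 - |(q : ℝ)|) with hc
  have hc0 : 0 ≤ c := by positivity
  have hcq : ‖h‖ ^ 2 + |(q : ℝ)| * c = c := by
    rw [hc]; field_simp; ring
  obtain ⟨n, hn⟩ := exists_iterate_annih_eq_zero ((q : ℝ) : ℂ) ((1 : ℂ) ⊗ₜ h) ξ
  induction n generalizing ξ with
  | zero =>
    obtain rfl : ξ = 0 := by simpa using hn
    have : vec q (0 : AlgFock H) = 0 := (vecLin q).map_zero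
    simp [this]
  | succ n ih =>
    have hd := ih (annihLetter q h ξ) (by rwa [pow_succ, Module.End.mul_apply] at hn)
    set a := ‖vec q (annihLetter q h ξ)‖
    set b := ‖vec q ξ‖
    set d := ‖vec q (letter h * annihLetter q h ξ)‖
    -- One annihilation is moved across, ⟨∂ξ, ∂ξ⟩ = ⟨h ∂ξ, ξ⟩, and Cauchy–Schwarz applies.
    have hab : a ^ 2 ≤ d * b := by
      have h1 := norm_inner_le_norm (𝕜 := ℂ) (vec q (letter h * annihLetter q h ξ)) (vec q ξ)
      rw [inner_vec_letter_mul, inner_self_eq_norm_sq_to_K] at h1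
      simpa using h1
    -- The induction hypothesis at ∂ξ gives d² ≤ c a²; squaring `hab` and cancelling a² transfers
    -- the bound from creation on ∂ξ to annihilation on ξ.
    have key : a ^ 2 ≤ c * b ^ 2 := by
      rcases (show 0 ≤ a from norm_nonneg _).eq_or_lt with h0 | h0
      · rw [← h0, zero_pow two_ne_zero]; exact mul_nonneg hc0 (sq_nonneg b)
      · refine le_of_mul_le_mul_left ?_ (pow_pos h0 2)
        calc a ^ 2 * a ^ 2 ≤ (d * b) * (d * b) := by gcongr
          _ = d ^ 2 * b ^ 2 := by ring
          _ ≤ (c * a ^ 2) * b ^ 2 := by gcongr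
          _ = a ^ 2 * (c * b ^ 2) := by ring
    calc ‖vec q (letter h * ξ)‖ ^ 2 = ‖h‖ ^ 2 * b ^ 2 + q * a ^ 2 := norm_sq_vec_letter_mul q h ξ
      _ ≤ ‖h‖ ^ 2 * b ^ 2 + |(q : ℝ)| * (c * b ^ 2) := by
        gcongr
        exact le_abs_self _
      _ = (‖h‖ ^ 2 + |(q : ℝ)| * c) * b ^ 2 := by ring
      _ = c * b ^ 2 := by rw [hcq]

lemma norm_vec_rev (ξ : AlgFock H) : ‖vec q (rev ξ)‖ = ‖vec q ξ‖ := by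
  have h : inner ℂ (vec q (rev ξ)) (vec q (rev ξ)) = inner ℂ (vec q ξ) (vec q ξ) := by
    rw [inner_vec, inner_vec, fockForm_rev]
  rw [inner_self_eq_norm_sq_to_K, inner_self_eq_norm_sq_to_K] at h
  exact (sq_eq_sq₀ (norm_nonneg _) (norm_nonneg _)).1 (by exact_mod_cast h)

lemma norm_vec_letter_mul_le (h : H) (ξ : AlgFock H) :
    ‖vec q (letter h * ξ)‖ ≤ √(‖h‖ ^ 2 / (1 - |(q : ℝ)|)) * ‖vec q ξ‖ := by
  rw [← Real.sqrt_sq (norm_nonneg (vec q ξ)), ← Real.sqrt_mul' _ (sq_nonneg _)]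
  exact Real.le_sqrt_of_sq_le (norm_sq_vec_letter_mul_le q h ξ)

lemma exists_extension (f : AlgFock H →ₗ[ℂ] AlgFock H) (C : ℝ)
    (hf : ∀ ξ, ‖vec q (f ξ)‖ ≤ C * ‖vec q ξ‖) :
    ∃ L : Fock q H →L[ℂ] Fock q H, ∀ ξ, L (vec q ξ) = vec q (f ξ) := by
  let g : QFock q H →ₗ[ℂ] Fock q H :=
    { toFun := fun ξ => vec q (f ξ)
      map_add' := fun ξ η => (congrArg (vec q) (f.map_add ξ η)).trans (vec_add q _ _)
      map_smul' := fun c ξ => (congrArg (vec q) (f.map_smul c ξ)).trans (vec_smul q _ _) }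
  let e : QFock q H →L[ℂ] Fock q H := UniformSpace.Completion.toComplL
  have hg : ∀ ξ : QFock q H, ‖g ξ‖ ≤ C * ‖ξ‖ := fun ξ => by
    rw [← UniformSpace.Completion.norm_coe ξ]; exact hf ξ
  refine ⟨(g.mkContinuous C hg).extend e, fun ξ => ?_⟩
  exact ContinuousLinearMap.extend_eq (g.mkContinuous C hg) (e := e)
    (UniformSpace.Completion.denseRange_coe (α := QFock q H))
    (UniformSpace.Completion.isUniformInducing_coe (QFock q H)) ξ

lemma exists_isCreation (h : H) : ∃ L, IsCreation q h L :=
  exists_extension q (LinearMap.mulLeft ℂ (letter h)) _ (norm_vec_letter_mul_le q h)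

lemma rev_letter (h : H) : rev (letter h) = letter h := by rw [letter_eq_gen, rev_gen]

lemma exists_right_creation (h : H) :
    ∃ R : Fock q H →L[ℂ] Fock q H, ∀ ξ, R (vec q ξ) = vec q (ξ * letter h) := by
  refine exists_extension q (LinearMap.mulRight ℂ (letter h)) (√(‖h‖ ^ 2 / (1 - |(q : ℝ)|)))
    fun ξ => ?_
  have := norm_vec_letter_mul_le q h (rev ξ)
  rwa [← norm_vec_rev, rev_mul, rev_rev, rev_letter, norm_vec_rev] at this

variable {q}

lemma IsCreation.adjoint_vec {h : H} {L : Fock q H →L[ℂ] Fock q H} (hL : IsCreation q h L)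
    (ξ : AlgFock H) : ContinuousLinearMap.adjoint L (vec q ξ) = vec q (annihLetter q h ξ) :=
  eq_of_inner_vec q fun η => by
    rw [ContinuousLinearMap.adjoint_inner_right, hL, inner_vec_letter_mul]

lemma adjoint_right_creation_vec {h : H} {R : Fock q H →L[ℂ] Fock q H}
    (hR : ∀ ξ, R (vec q ξ) = vec q (ξ * letter h)) (ξ : AlgFock H) :
    ContinuousLinearMap.adjoint R (vec q ξ) = vec q (rev (annihLetter q h (rev ξ))) :=
  eq_of_inner_vec q fun η => by
    rw [ContinuousLinearMap.adjoint_inner_right, hR, inner_vec, ← fockForm_rev, rev_mul,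
      rev_letter, fockForm_letter_mul, ← fockForm_rev, rev_rev, inner_vec]
    rfl

/-- The left and the right `q`-Gaussian operators commute. -/
lemma IsCreation.commute_right {h k : H} {L R : Fock q H →L[ℂ] Fock q H} (hL : IsCreation q k L)
    (hR : ∀ ξ, R (vec q ξ) = vec q (ξ * letter h)) :
    (L + ContinuousLinearMap.adjoint L) * (R + ContinuousLinearMap.adjoint R) =
      (R + ContinuousLinearMap.adjoint R) * (L + ContinuousLinearMap.adjoint L) := by
  have h1 : L * R = R * L := ext_vec q fun ξ => by
    simp only [mul_apply_eq_comp, hR, hL _, mul_assoc]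
  have h2 : ContinuousLinearMap.adjoint L * ContinuousLinearMap.adjoint R =
      ContinuousLinearMap.adjoint R * ContinuousLinearMap.adjoint L := by
    have := congrArg ContinuousLinearMap.adjoint h1
    rw [ContinuousLinearMap.mul_def, ContinuousLinearMap.mul_def, ContinuousLinearMap.adjoint_comp,
      ContinuousLinearMap.adjoint_comp] at this
    exact this.symm
  -- The mixed commutators do not vanish separately: L*R − RL* and R*L − LR* both equal ⟨k, h⟩ q^N,
  -- and these cancel.
  have h3 : ContinuousLinearMap.adjoint L * R + L * ContinuousLinearMap.adjoint R =
      R * ContinuousLinearMap.adjoint L + ContinuousLinearMap.adjoint R * L := ext_vec q fun ξ => by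
    simp only [add_apply, mul_apply_eq_comp, hR, hL _,
      hL.adjoint_vec, adjoint_right_creation_vec hR, ← vec_add]
    congr 1
    rw [annihLetter, annihLetter, annih_mul, letter_eq_gen, letter_eq_gen, annih_gen,
      rev_annih_rev_gen_mul, bil_symm, mul_smul_comm, mul_one]
    abel
  calc _ = L * R + (ContinuousLinearMap.adjoint L * R + L * ContinuousLinearMap.adjoint R) +
        ContinuousLinearMap.adjoint L * ContinuousLinearMap.adjoint R := by noncomm_ring
    _ = R * L + (R * ContinuousLinearMap.adjoint L + ContinuousLinearMap.adjoint R * L) +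
        ContinuousLinearMap.adjoint R * ContinuousLinearMap.adjoint L := by rw [h1, h2, h3]
    _ = _ := by noncomm_ring

/-! ### The Gaussian algebra: separating vacuum, existence and recursion of the Wick map. -/

variable (q H)

/-- The `q`-Gaussian von Neumann algebra as a subalgebra of the bounded operators. -/
def gaussianSubalgebra : Subalgebra ℂ (Fock q H →L[ℂ] Fock q H) :=
  Subalgebra.centralizer ℂ (Set.centralizer
    {s | ∃ (h : H) (L : Fock q H →L[ℂ] Fock q H), IsCreation q h L ∧
      s = L + ContinuousLinearMap.adjoint L})

variable {H}

lemma exists_gaussian (h : H) : ∃ s ∈ gaussianSubalgebra q H,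
    ∀ ξ, s (vec q ξ) = vec q (letter h * ξ) + vec q (annihLetter q h ξ) := by
  obtain ⟨L, hL⟩ := exists_isCreation q h
  refine ⟨L + ContinuousLinearMap.adjoint L,
    Set.subset_centralizer_centralizer ⟨h, L, hL, rfl⟩, fun ξ => ?_⟩
  rw [add_apply, hL, hL.adjoint_vec]

/-- The vacuum vector is separating for the `q`-Gaussian algebra. -/
lemma eq_of_apply_vacuum_eq {x y : Fock q H →L[ℂ] Fock q H} (hx : x ∈ gaussianSubalgebra q H)
    (hy : y ∈ gaussianSubalgebra q H) (h : x (vacuum q H) = y (vacuum q H)) : x = y := by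
  -- Composing with `rev` turns the left-letter induction into one that adds letters on the right,
  -- where the commuting operators R + R* act.
  let p : Submodule ℂ (AlgFock H) := LinearMap.eqLocus (x.toLinearMap ∘ₗ vecLin q ∘ₗ rev)
    (y.toLinearMap ∘ₗ vecLin q ∘ₗ rev)
  have hp : ∀ ξ, ξ ∈ p ↔ x (vec q (rev ξ)) = y (vec q (rev ξ)) := fun ξ => Iff.rfl
  have key : ∀ ξ, ξ ∈ p := by
    refine mem_of_letter_mul_mem ((q : ℝ) : ℂ) ?_ fun k ξ hξ hd => ?_
    · rw [hp, rev_one]; exact h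
    · obtain ⟨R, hR⟩ := exists_right_creation q k
      have hT : R + ContinuousLinearMap.adjoint R ∈ Set.centralizer
          {s | ∃ (h : H) (L : Fock q H →L[ℂ] Fock q H), IsCreation q h L ∧
            s = L + ContinuousLinearMap.adjoint L} := by
        rintro _ ⟨h, L, hL, rfl⟩
        exact hL.commute_right hR
      -- The new vector is (R + R*) applied to the old one, minus an annihilated vector. Both `x`
      -- and `y` commute with R + R*, so agreement carries over.
      have hv : vec q (rev (letter k * ξ)) = (R + ContinuousLinearMap.adjoint R) (vec q (rev ξ)) -
          vec q (rev (annih ((q : ℝ) : ℂ) ((1 : ℂ) ⊗ₜ k) ξ)) := by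
        rw [add_apply, hR, adjoint_right_creation_vec hR, rev_rev, rev_mul,
          rev_letter]
        exact (add_sub_cancel_right _ _).symm
      have hxT := fun v => DFunLike.congr_fun (hx _ hT) v
      have hyT := fun v => DFunLike.congr_fun (hy _ hT) v
      simp only [mul_apply_eq_comp] at hxT hyT
      rw [hp] at hξ hd ⊢
      rw [hv, map_sub, map_sub, ← hxT, ← hyT, hξ, hd]
  exact ext_vec q fun ξ => by simpa using (hp _).1 (key (rev ξ))

/-- If x and y send Ω to ξ and ∂_h ξ, then s_q(h) x − y sends Ω to hξ. -/
lemma exists_apply_vacuum_eq (ξ : AlgFock H) :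
    ∃ x ∈ gaussianSubalgebra q H, x (vacuum q H) = vec q ξ := by
  let p : Submodule ℂ (AlgFock H) :=
    { carrier := {ξ | ∃ x ∈ gaussianSubalgebra q H, x (vacuum q H) = vec q ξ}
      add_mem' := by
        rintro a b ⟨x, hx, hxa⟩ ⟨y, hy, hyb⟩
        exact ⟨x + y, add_mem hx hy, by rw [add_apply, hxa, hyb, vec_add]⟩
      zero_mem' := ⟨0, zero_mem _, ((vecLin q).map_zero).symm⟩
      smul_mem' := by
        rintro c a ⟨x, hx, hxa⟩
        exact ⟨c • x, (gaussianSubalgebra q H).smul_mem hx c, by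
          rw [smul_apply, hxa, vec_smul]⟩ }
  refine mem_of_letter_mul_mem (p := p) ((q : ℝ) : ℂ) ⟨1, one_mem _, rfl⟩ ?_ ξ
  rintro h ξ ⟨x, hx, hxξ⟩ ⟨y, hy, hyξ⟩
  obtain ⟨s, hs, hsξ⟩ := exists_gaussian q h
  refine ⟨s * x - y, sub_mem (mul_mem hs hx) hy, ?_⟩
  rw [sub_apply, mul_apply_eq_comp, hxξ, hyξ, hsξ]
  exact add_sub_cancel_right _ _

/-- The pointwise choice is automatically linear, because the vacuum is separating. -/
lemma existsUnique_isWickMap :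
    ∃! W : AlgFock H →ₗ[ℂ] (Fock q H →L[ℂ] Fock q H), IsWickMap q H W := by
  choose w hw hwΩ using exists_apply_vacuum_eq q (H := H)
  let W : AlgFock H →ₗ[ℂ] (Fock q H →L[ℂ] Fock q H) :=
    { toFun := w
      map_add' := fun ξ η => eq_of_apply_vacuum_eq q (hw _) (add_mem (hw _) (hw _)) (by
        rw [add_apply, hwΩ, hwΩ, hwΩ, vec_add])
      map_smul' := fun c ξ => eq_of_apply_vacuum_eq q (hw _)
        ((gaussianSubalgebra q H).smul_mem (hw _) c) (by
        rw [RingHom.id_apply, smul_apply, hwΩ, hwΩ, vec_smul]) }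
  refine ⟨W, fun ξ x => ⟨fun hx => ?_, ?_⟩, fun W' hW' => LinearMap.ext fun ξ =>
    ((hW' ξ (w ξ)).1 ⟨hw ξ, hwΩ ξ⟩).symm⟩
  · exact eq_of_apply_vacuum_eq q hx.1 (hw ξ) (hx.2.trans (hwΩ ξ).symm)
  · rintro rfl; exact ⟨hw ξ, hwΩ ξ⟩

variable {q}

lemma IsWickMap.map_one {W : AlgFock H →ₗ[ℂ] (Fock q H →L[ℂ] Fock q H)} (hW : IsWickMap q H W) :
    W 1 = 1 :=
  ((hW 1 1).1 ⟨one_mem (gaussianSubalgebra q H), rfl⟩).symm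

/-- With s = s_q(h), the right side lies in the algebra and sends Ω to hξ, which characterises
W(hξ). -/
lemma IsWickMap.exists_map_letter_mul {W : AlgFock H →ₗ[ℂ] (Fock q H →L[ℂ] Fock q H)}
    (hW : IsWickMap q H W) (h : H) : ∃ s : Fock q H →L[ℂ] Fock q H, ∀ ξ,
      W (letter h * ξ) = s * W ξ - W (annih ((q : ℝ) : ℂ) ((1 : ℂ) ⊗ₜ h) ξ) := by
  obtain ⟨s, hs, hsξ⟩ := exists_gaussian q h
  have hmem : ∀ ξ, W ξ ∈ gaussianSubalgebra q H ∧ W ξ (vacuum q H) = vec q ξ :=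
    fun ξ => (hW ξ (W ξ)).2 rfl
  refine ⟨s, fun ξ => ((hW _ _).1
    ⟨sub_mem (mul_mem hs (hmem ξ).1) (hmem _).1, ?_⟩).symm⟩
  rw [sub_apply, mul_apply_eq_comp, (hmem _).2, (hmem _).2, hsξ]
  exact add_sub_cancel_right _ _

end Operators

end QGaussian

end

theorem proposition3 {H : Type*} [NormedAddCommGroup H] [InnerProductSpace ℝ H] [CompleteSpace H]
    (q : Set.Ioo (-1 : ℝ) 1) :
    (∃! W : QGaussian.AlgFock H →ₗ[ℂ] (QGaussian.Fock q H →L[ℂ] QGaussian.Fock q H),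
      QGaussian.IsWickMap q H W) ∧
    ∀ W : QGaussian.AlgFock H →ₗ[ℂ] (QGaussian.Fock q H →L[ℂ] QGaussian.Fock q H),
      QGaussian.IsWickMap q H W →
      ∀ n k : ℕ, k ≤ n →
        QGaussian.betaMap W n k =
          ∑ j ∈ Finset.range (max k (n - k) + 1),
            ((-1 : ℂ) ^ j * ((q : ℝ) : ℂ) ^ (j.choose 2)) •
              QGaussian.wMap (q : ℝ) W n k j := by
  refine ⟨QGaussian.existsUnique_isWickMap q, fun W hW n k _ => ?_⟩
  choose s hs using hW.exists_map_letter_mul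
  exact QGaussian.betaMap_eq_sum_wMap W (q : ℝ) s hW.map_one hs n k
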